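/- Let $n\ge 2$ and let $\kappa_0,\kappa,\kappa_n,\psi_0,\psi_n\in\mathbb{C}^*$; put $\kappa_i:=\kappa$ for $1\le i<n$. Let $\mathcal B$ be the affine braid group of type $\widetilde C_n$, with generators $\sigma_0,\dots,\sigma_n$ and relations $\sigma_0\sigma_1\sigma_0\sigma_1=\sigma_1\sigma_0\sigma_1\sigma_0$, $\sigma_{n-1}\sigma_n\sigma_{n-1}\sigma_n=\sigma_n\sigma_{n-1}\sigma_n\sigma_{n-1}$, $\sigma_i\sigma_{i+1}\sigma_i=\sigma_{i+1}\sigma_i\sigma_{i+1}$ for $1\le i<n-1$, and $\sigma_i\sigma_j=\sigma_j\sigma_i$ for $0\le i,j\le n$ with $|i-j|>1$. The affine Hecke algebra $H=H(\underline\kappa)$ is the quotient of $\mathbb{C}[\mathcal B]$ by the two-sided ideal generated by the elements $(\sigma_j-\kappa_j)(\sigma_j+\kappa_j^{-1})$, $0\le j\le n$. Let $T_j$ be the image of $\sigma_j$ in $H$, let $$Y_i:=T_{i-1}^{-1}\cdots T_1^{-1}\,T_0T_1\cdots T_{n-1}T_n\,T_{n-1}\cdots T_i\qquad(1\le i\le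 n),$$ and let $Y^\lambda:=Y_1^{\lambda_1}\cdots Y_n^{\lambda_n}$ for $\lambda\in\mathbb{Z}^n$. The spin representation $\rho_{\psi_0,\psi_n}$ is the representation of $H$ on $(\mathbb{C}^2)^{\otimes n}$ given by $T_0\mapsto\bar K_1$, $T_i\mapsto(\Upsilon\circ P)_{i,i+1}$ $(1\le i<n)$ and $T_n\mapsto K_n$, where the subscripts indicate the tensor legs on which an operator acts, $P(v\otimes w)=w\otimes v$, and, with respect to the ordered basis $(v_+,v_-)$ of $\mathbb{C}^2$ and the ordered basis $(v_+\otimes v_+,v_+\otimes v_-,v_-\otimes v_+,v_-\otimes v_-)$ of $\mathbb{C}^2\otimes\mathbb{C}^2$, $$\bar K=\begin{pmatrix}\kappa_0-\kappa_0^{-1}&\psi_0\\ \psi_0^{-1}&0\end{pmatrix},\quad K=\begin{pmatrix}0&\psi_n^{-1}\\ \psi_n&\kappa_n-\kappa_n^{-1}\end{pmatrix},\quad \Upsilon=\begin{pmatrix}\kappa&0&0&0\\0&1&0&0\\0&\kappa-\kappa^{-1}&1&0\\0&0&0&\kappa\end{pmatrix}.$$ For $I\subseteq\{1,\dots,n\}$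 let $H_I$ be the subalgebra of $H$ generated by the $T_i$ $(i\in I)$ and all $Y^\lambda$ $(\lambda\in\mathbb{Z}^n)$, and let $T_I$ be the set of those $\gamma\in(\mathbb{C}^*)^n$ with $\gamma_n=\kappa_0\kappa_n$ if $n\in I$ and $\gamma_i/\gamma_{i+1}=\kappa^2$ for all $i\in I$ with $i<n$. For $\gamma\in T_I$ let $\chi_{I,\gamma}:H_I\to\mathbb{C}$ be the algebra map with $T_i\mapsto\kappa_i$ $(i\in I)$ and $Y^\lambda\mapsto\gamma_1^{\lambda_1}\cdots\gamma_n^{\lambda_n}$ $(\lambda\in\mathbb{Z}^n)$, and let $M_I(\gamma):=H\otimes_{H_I}\mathbb{C}_{I,\gamma}$ be the principal series module, where $\mathbb{C}_{I,\gamma}$ is $\mathbb{C}$ with $H_I$ acting through $\chi_{I,\gamma}$. **Proposition.** Let $J:=\{1,\dots,n-1\}$ and $$\zeta:=(\psi_0\psi_n\kappa^{n-1},\psi_0\psi_n\kappa^{n-3},\dots,\psi_0\psi_n\kappa^{1-n}).$$ Then $\zeta\in T_J$, there is a unique algebra map $\chi_{J,\zeta}$ as above, and the spin representation $\rho_{\psi_0,\psi_n}$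 of $H$ on $(\mathbb{C}^2)^{\otimes n}$ is isomorphic to the principal series module $M_J(\zeta)$. -/

import Mathlib

open scoped TensorProduct

namespace SpinHecke

noncomputable section

/-! ### The affine braid group of type `C̃ₙ` -/

/-- The free generator `σ_k`, for a natural number `0 ≤ k ≤ n`
(only such values of `k` are ever used). -/
def freeGen (n k : ℕ) : FreeGroup (Fin (n + 1)) := FreeGroup.of (Fin.ofNat (n + 1) k)

/-- The braid relations of type `C̃ₙ`, for `n ≥ 2`, as relators. -/
inductive BraidRel (n : ℕ) : FreeGroup (Fin (n + 1)) → Prop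
  | left : BraidRel n
      ((freeGen n 0 * freeGen n 1 * freeGen n 0 * freeGen n 1) *
        (freeGen n 1 * freeGen n 0 * freeGen n 1 * freeGen n 0)⁻¹)
  | right : BraidRel n
      ((freeGen n (n - 1) * freeGen n n * freeGen n (n - 1) * freeGen n n) *
        (freeGen n n * freeGen n (n - 1) * freeGen n n * freeGen n (n - 1))⁻¹)
  | middle (i : ℕ) (h1 : 1 ≤ i) (h2 : i + 1 < n) : BraidRel n
      ((freeGen n i * freeGen n (i + 1) * freeGen n i) *
        (freeGen n (i + 1) * freeGen n i * freeGen n (i + 1))⁻¹)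
  | far (i j : ℕ) (h1 : i + 1 < j) (h2 : j ≤ n) : BraidRel n
      ((freeGen n i * freeGen n j) * (freeGen n j * freeGen n i)⁻¹)

/-- The affine braid group of type `C̃ₙ`. -/
abbrev BraidGroup (n : ℕ) : Type := PresentedGroup {r | BraidRel n r}

/-- The generator `σ_k` of the affine braid group, `0 ≤ k ≤ n`. -/
def sigma (n k : ℕ) : BraidGroup n := PresentedGroup.of (Fin.ofNat (n + 1) k)

/-- The element
`σ_{m-1}⁻¹ ⋯ σ_1⁻¹ · σ_0 σ_1 ⋯ σ_{n-1} σ_n · σ_{n-1} ⋯ σ_m` with `m = i + 1`, for `i : Fin n`. -/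
def braidG (n : ℕ) (i : Fin n) : BraidGroup n :=
  ((List.range i).reverse.map fun k => (sigma n (k + 1))⁻¹).prod *
  ((List.range (n + 1)).map fun k => sigma n k).prod *
  ((List.range' (i + 1) (n - 1 - i)).reverse.map fun k => sigma n k).prod

/-- The element `g_1^{λ_1} ⋯ g_n^{λ_n}` of the braid group. -/
def braidGPow (n : ℕ) (l : Fin n → ℤ) : BraidGroup n :=
  (List.ofFn fun i : Fin n => braidG n i ^ l i).prod

/-! ### The affine Hecke algebra -/

/-- The parameters `(κ_0, κ_1, …, κ_n)` with `κ_1 = ⋯ = κ_{n-1} = κ`. -/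
def heckeParam (n : ℕ) (κ₀ κ κₙ : ℂˣ) (j : Fin (n + 1)) : ℂˣ :=
  if (j : ℕ) = 0 then κ₀ else if (j : ℕ) = n then κₙ else κ

/-- The element of the group algebra `ℂ[B]` given by a braid. -/
def groupAlg (n : ℕ) : BraidGroup n →* MonoidAlgebra ℂ (BraidGroup n) :=
  MonoidAlgebra.of ℂ (BraidGroup n)

/-- The relations `(σ_j - κ_j)(σ_j + κ_j⁻¹) = 0` in the group algebra of the braid group. -/
inductive HeckeRel (n : ℕ) (κ₀ κ κₙ : ℂˣ) :
    MonoidAlgebra ℂ (BraidGroup n) → MonoidAlgebra ℂ (BraidGroup n) → Prop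
  | quad (j : Fin (n + 1)) : HeckeRel n κ₀ κ κₙ
      ((groupAlg n (sigma n j) - algebraMap ℂ _ (heckeParam n κ₀ κ κₙ j : ℂ)) *
        (groupAlg n (sigma n j) + algebraMap ℂ _ ((heckeParam n κ₀ κ κₙ j)⁻¹ : ℂˣ))) 0

/-- The affine Hecke algebra of type `C̃ₙ`: the quotient of `ℂ[B]` by the two-sided ideal
generated by the elements `(σ_j - κ_j)(σ_j + κ_j⁻¹)`. -/
abbrev Hecke (n : ℕ) (κ₀ κ κₙ : ℂˣ) : Type := RingQuot (HeckeRel n κ₀ κ κₙ)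

/-- The canonical map from braids to the affine Hecke algebra. -/
def braidToHecke (n : ℕ) (κ₀ κ κₙ : ℂˣ) : BraidGroup n →* Hecke n κ₀ κ κₙ :=
  (RingQuot.mkAlgHom ℂ (HeckeRel n κ₀ κ κₙ) :
    MonoidAlgebra ℂ (BraidGroup n) →* Hecke n κ₀ κ κₙ).comp (groupAlg n)

/-- The generators `T_0, …, T_n` of the affine Hecke algebra. -/
def T (n : ℕ) (κ₀ κ κₙ : ℂˣ) (j : Fin (n + 1)) : Hecke n κ₀ κ κₙ :=
  braidToHecke n κ₀ κ κₙ (sigma n j)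

/-- The elements `Y^λ = Y_1^{λ_1} ⋯ Y_n^{λ_n}` of the affine Hecke algebra. -/
def Y (n : ℕ) (κ₀ κ κₙ : ℂˣ) (l : Fin n → ℤ) : Hecke n κ₀ κ κₙ :=
  braidToHecke n κ₀ κ κₙ (braidGPow n l)

/-! ### Principal series modules

A subset `I ⊆ {1, …, n}` is encoded as a `Set (Fin n)`, with `i : Fin n` standing for `i + 1`,
which is the value of `i.succ : Fin (n + 1)`. -/

/-- The subalgebra `H_I` generated by the `T_i`, `i ∈ I`, and all `Y^λ`. -/
def heckeSub (n : ℕ) (κ₀ κ κₙ : ℂˣ) (I : Set (Fin n)) : Subalgebra ℂ (Hecke n κ₀ κ κₙ) :=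
  Algebra.adjoin ℂ ((fun i : Fin n => T n κ₀ κ κₙ i.succ) '' I ∪ Set.range (Y n κ₀ κ κₙ))

/-- The set `T_I` of those `γ ∈ (ℂ^*)^n` such that `γ_n = κ_0 κ_n` if `n ∈ I`, and
`γ_i / γ_{i+1} = κ²` if `i ∈ I`, `i < n`. -/
def torusSub (n : ℕ) (κ₀ κ κₙ : ℂˣ) (I : Set (Fin n)) : Set (Fin n → ℂˣ) :=
  {γ | (∀ i ∈ I, (i : ℕ) + 1 = n → γ i = κ₀ * κₙ) ∧
    ∀ i ∈ I, ∀ j : Fin n, (j : ℕ) = i + 1 → γ i / γ j = κ ^ 2}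

theorem T_mem_heckeSub {n : ℕ} (κ₀ κ κₙ : ℂˣ) {I : Set (Fin n)} {i : Fin n} (hi : i ∈ I) :
    T n κ₀ κ κₙ i.succ ∈ heckeSub n κ₀ κ κₙ I :=
  Algebra.subset_adjoin (Or.inl ⟨i, hi, rfl⟩)

theorem Y_mem_heckeSub {n : ℕ} (κ₀ κ κₙ : ℂˣ) (I : Set (Fin n)) (l : Fin n → ℤ) :
    Y n κ₀ κ κₙ l ∈ heckeSub n κ₀ κ κₙ I :=
  Algebra.subset_adjoin (Or.inr ⟨l, rfl⟩)

/-- `χ` is the character `χ_{I,γ}` of `H_I`: it sends `T_i` to `κ_i` for `i ∈ I` and `Y^λ` to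
`γ^λ = γ_1^{λ_1} ⋯ γ_n^{λ_n}`. -/
def IsPrincipalChar (n : ℕ) (κ₀ κ κₙ : ℂˣ) (I : Set (Fin n)) (γ : Fin n → ℂˣ)
    (χ : heckeSub n κ₀ κ κₙ I →ₐ[ℂ] ℂ) : Prop :=
  (∀ (i : Fin n) (hi : i ∈ I),
      χ ⟨T n κ₀ κ κₙ i.succ, T_mem_heckeSub κ₀ κ κₙ hi⟩ = (heckeParam n κ₀ κ κₙ i.succ : ℂ)) ∧
  (∀ l : Fin n → ℤ,
      χ ⟨Y n κ₀ κ κₙ l, Y_mem_heckeSub κ₀ κ κₙ I l⟩ = ((∏ i, γ i ^ l i : ℂˣ) : ℂ))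

section Induced

variable {A : Type*} [Ring A] [Algebra ℂ A]

/-- The `A`-submodule of `A ⊗_ℂ ℂ` generated by the elements `ab ⊗ z - a ⊗ χ(b) z`
with `a ∈ A`, `b ∈ B`, `z ∈ ℂ`. -/
def inducedRel (B : Subalgebra ℂ A) (χ : B →ₐ[ℂ] ℂ) : Submodule A (A ⊗[ℂ] ℂ) :=
  Submodule.span A {x | ∃ (a : A) (b : B) (z : ℂ), x = (a * b) ⊗ₜ[ℂ] z - a ⊗ₜ[ℂ] (χ b * z)}

/-- The induced module `A ⊗_B ℂ_χ`, where `ℂ_χ` is `ℂ` with `B` acting through the character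
`χ`: the quotient of `A ⊗_ℂ ℂ` that balances the right action of `B` on `A` with its left action
on `ℂ_χ`, with `A` acting by left multiplication on the first factor. -/
abbrev Induced (B : Subalgebra ℂ A) (χ : B →ₐ[ℂ] ℂ) : Type _ := (A ⊗[ℂ] ℂ) ⧸ inducedRel B χ

/-- The representation map of the induced module: `h · (h' ⊗ z) = (h h') ⊗ z`. -/
def inducedRep (B : Subalgebra ℂ A) (χ : B →ₐ[ℂ] ℂ) : A →ₐ[ℂ] Module.End ℂ (Induced B χ) :=
  Algebra.lsmul ℂ ℂ (Induced B χ)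

/-- Two representations of `A` are isomorphic if there is an invertible intertwiner. -/
def RepIso {V W : Type*} [AddCommMonoid V] [Module ℂ V] [AddCommMonoid W] [Module ℂ W]
    (ρ : A →ₐ[ℂ] Module.End ℂ V) (π : A →ₐ[ℂ] Module.End ℂ W) : Prop :=
  ∃ e : V ≃ₗ[ℂ] W, ∀ (h : A) (v : V), e (ρ h v) = π h (e v)

end Induced

/-- The representation map `π_{I,γ}` of the principal series module
`M_I(γ) = H ⊗_{H_I} ℂ_{I,γ}`, where `χ` is the character `χ_{I,γ}`. -/
def principalSeries (n : ℕ) (κ₀ κ κₙ : ℂˣ) (I : Set (Fin n))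
    (χ : heckeSub n κ₀ κ κₙ I →ₐ[ℂ] ℂ) :
    Hecke n κ₀ κ κₙ →ₐ[ℂ] Module.End ℂ (Induced (heckeSub n κ₀ κ κₙ I) χ) :=
  inducedRep (heckeSub n κ₀ κ κₙ I) χ

/-! ### Operators on `(ℂ²)^{⊗ n}` in tensor leg notation -/

/-- The space `(ℂ²)^{⊗ n}`. The ordered basis `(v_+, v_-)` of `ℂ²` is the standard basis
of `Fin 2 → ℂ`. -/
abbrev SpinSpace (n : ℕ) : Type := ⨂[ℂ] (_ : Fin n), (Fin 2 → ℂ)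

/-- The operator `A_i`: the `2 × 2` matrix `A` acting on the `i`-th tensor leg. -/
def leg {n : ℕ} (i : Fin n) (A : Matrix (Fin 2) (Fin 2) ℂ) : Module.End ℂ (SpinSpace n) :=
  PiTensorProduct.map (Function.update (fun _ => LinearMap.id) i (Matrix.toLin' A))

/-- The operator `M_{i,j}`, for `M` a matrix with respect to the basis
`v_a ⊗ v_b` of `ℂ² ⊗ ℂ²`: since `M` is the sum of the `M_{(a,b),(c,d)} E_{ac} ⊗ E_{bd}`,
it acts on the legs `i ≠ j` as the sum of the `M_{(a,b),(c,d)} (E_{ac})_i (E_{bd})_j`. -/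
def leg2 {n : ℕ} (i j : Fin n) (M : Matrix (Fin 2 × Fin 2) (Fin 2 × Fin 2) ℂ) :
    Module.End ℂ (SpinSpace n) :=
  ∑ a : Fin 2, ∑ b : Fin 2, ∑ c : Fin 2, ∑ d : Fin 2,
    M (a, b) (c, d) • (leg i (Matrix.single a c 1) * leg j (Matrix.single b d 1))

/-- A `4 × 4` matrix with respect to the ordered basis
`(v_+ ⊗ v_+, v_+ ⊗ v_-, v_- ⊗ v_+, v_- ⊗ v_-)`, reindexed by pairs. -/
def toPairs (M : Matrix (Fin 4) (Fin 4) ℂ) : Matrix (Fin 2 × Fin 2) (Fin 2 × Fin 2) ℂ :=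
  Matrix.of fun p q => M (finProdFinEquiv p) (finProdFinEquiv q)

/-- The matrix `K̄`. -/
def KBar (κ₀ ψ₀ : ℂˣ) : Matrix (Fin 2) (Fin 2) ℂ :=
  !![(κ₀ : ℂ) - (κ₀ : ℂ)⁻¹, (ψ₀ : ℂ); (ψ₀ : ℂ)⁻¹, 0]

/-- The matrix `K`. -/
def KMat (κₙ ψₙ : ℂˣ) : Matrix (Fin 2) (Fin 2) ℂ :=
  !![0, (ψₙ : ℂ)⁻¹; (ψₙ : ℂ), (κₙ : ℂ) - (κₙ : ℂ)⁻¹]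

/-- The matrix `Υ`. -/
def Upsilon (κ : ℂˣ) : Matrix (Fin 2 × Fin 2) (Fin 2 × Fin 2) ℂ :=
  toPairs !![(κ : ℂ), 0, 0, 0; 0, 1, 0, 0; 0, (κ : ℂ) - (κ : ℂ)⁻¹, 1, 0; 0, 0, 0, (κ : ℂ)]

/-- The matrix of the flip operator `P (v ⊗ w) = w ⊗ v`. -/
def flipMat : Matrix (Fin 2 × Fin 2) (Fin 2 × Fin 2) ℂ :=
  Matrix.of fun p q => if p = q.swap then 1 else 0

/-- The operators by which `T_0, …, T_n` act in the spin representation: `K̄_1` for `j = 0`,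
`K_n` for `j = n`, and `(Υ ∘ P)_{j,j+1}` for `1 ≤ j < n` (the legs are numbered from `0`
in `Fin n`). -/
def spinGen (n : ℕ) (hn : 2 ≤ n) (κ₀ κ κₙ ψ₀ ψₙ : ℂˣ) (j : Fin (n + 1)) :
    Module.End ℂ (SpinSpace n) :=
  if h0 : (j : ℕ) = 0 then leg ⟨0, by omega⟩ (KBar κ₀ ψ₀)
  else if hl : (j : ℕ) = n then leg ⟨n - 1, by omega⟩ (KMat κₙ ψₙ)
  else leg2 ⟨j - 1, by omega⟩ ⟨j, by omega⟩ (Upsilon κ * flipMat)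

/-! ### The defining relations of the spin representation -/

/-- The pure tensor `v_{ε_1} ⊗ ⋯ ⊗ v_{ε_n}`. -/
def spinVec {n : ℕ} (ε : Fin n → Fin 2) : SpinSpace n :=
  PiTensorProduct.tprod ℂ fun k => Pi.single (ε k) (1 : ℂ)

theorem end_ext {n : ℕ} {f g : Module.End ℂ (SpinSpace n)}
    (h : ∀ ε : Fin n → Fin 2, f (spinVec ε) = g (spinVec ε)) : f = g := by
  apply PiTensorProduct.ext
  apply Module.Basis.ext_multilinear (fun _ : Fin n => Pi.basisFun ℂ (Fin 2))
  intro v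
  simpa [spinVec] using h v

theorem leg_spinVec {n : ℕ} (i : Fin n) (A : Matrix (Fin 2) (Fin 2) ℂ) (ε : Fin n → Fin 2) :
    leg i A (spinVec ε) = ∑ a, A a (ε i) • spinVec (Function.update ε i a) := by
  unfold leg spinVec
  rw [PiTensorProduct.map_tprod]
  have h1 : (fun k => (Function.update (fun _ : Fin n => LinearMap.id) i (Matrix.toLin' A)
      : Fin n → (Fin 2 → ℂ) →ₗ[ℂ] (Fin 2 → ℂ)) k (Pi.single (ε k) 1)) =
      Function.update (fun k => (Pi.single (ε k) 1 : Fin 2 → ℂ)) i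
        (∑ a, A a (ε i) • (Pi.single a 1 : Fin 2 → ℂ)) := by
    funext k
    by_cases hk : k = i
    · subst hk
      simp only [Function.update_self]
      ext a
      simp [Pi.single_apply]
    · simp [hk]
  rw [h1, MultilinearMap.map_update_sum]
  refine Finset.sum_congr rfl fun a _ => ?_
  rw [MultilinearMap.map_update_smul]
  congr 2
  funext k
  by_cases hk : k = i
  · subst hk; simp
  · simp [hk]

theorem leg2_spinVec {n : ℕ} {i j : Fin n} (hij : i ≠ j)
    (M : Matrix (Fin 2 × Fin 2) (Fin 2 × Fin 2) ℂ) (ε : Fin n → Fin 2) :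
    leg2 i j M (spinVec ε) = ∑ a, ∑ b, M (a, b) (ε i, ε j) •
      spinVec (Function.update (Function.update ε i a) j b) := by
  have key : ∀ a b c d : Fin 2, (leg i (Matrix.single a c 1) * leg j (Matrix.single b d 1))
      (spinVec ε) = if c = ε i ∧ d = ε j then
        spinVec (Function.update (Function.update ε i a) j b) else 0 := by
    intro a b c d
    rw [Module.End.mul_apply, leg_spinVec, map_sum]
    simp only [map_smul, leg_spinVec, Function.update_of_ne hij, Matrix.single_apply]
    by_cases hc : c = ε i <;> by_cases hd : d = ε j <;> simp [hc, hd]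
    rw [Function.update_comm hij.symm]
  simp only [leg2, LinearMap.sum_apply, LinearMap.smul_apply, key]
  refine Finset.sum_congr rfl fun a _ => Finset.sum_congr rfl fun b _ => ?_
  rw [Finset.sum_eq_single (ε i), Finset.sum_eq_single (ε j)]
  · simp
  · intro x _ hx; simp [hx]
  · simp
  · intro x _ hx; simp [hx]
  · simp

theorem leg_commute {n : ℕ} {i j : Fin n} (hij : i ≠ j) (A B : Matrix (Fin 2) (Fin 2) ℂ) :
    Commute (leg i A) (leg j B) := by
  apply end_ext
  intro ε
  simp only [Module.End.mul_apply, leg_spinVec, map_sum, map_smul,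
    Function.update_of_ne hij, Function.update_of_ne hij.symm]
  simp only [Finset.smul_sum]
  rw [Finset.sum_comm]
  refine Finset.sum_congr rfl fun a _ => Finset.sum_congr rfl fun b _ => ?_
  rw [smul_comm, Function.update_comm hij.symm]

theorem leg_commute_leg2 {n : ℕ} {i j k : Fin n} (hj : i ≠ j) (hk : i ≠ k)
    (A : Matrix (Fin 2) (Fin 2) ℂ) (M : Matrix (Fin 2 × Fin 2) (Fin 2 × Fin 2) ℂ) :
    Commute (leg i A) (leg2 j k M) := by
  unfold leg2
  refine Commute.sum_right _ _ _ fun a _ => Commute.sum_right _ _ _ fun b _ =>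
    Commute.sum_right _ _ _ fun c _ => Commute.sum_right _ _ _ fun d _ => ?_
  exact ((leg_commute hj _ _).mul_right (leg_commute hk _ _)).smul_right _

theorem leg2_commute {n : ℕ} {i j k l : Fin n} (h1 : i ≠ k) (h2 : i ≠ l) (h3 : j ≠ k)
    (h4 : j ≠ l) (M N : Matrix (Fin 2 × Fin 2) (Fin 2 × Fin 2) ℂ) :
    Commute (leg2 i j M) (leg2 k l N) := by
  rw [leg2]
  refine Commute.sum_left _ _ _ fun a _ => Commute.sum_left _ _ _ fun b _ =>
    Commute.sum_left _ _ _ fun c _ => Commute.sum_left _ _ _ fun d _ => ?_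
  exact ((leg_commute_leg2 h1 h2 _ _).mul_left (leg_commute_leg2 h3 h4 _ _)).smul_left _

/-- `T_i` on two neighbouring legs. -/
theorem upsilon_flip (κ : ℂˣ) (a b c d : Fin 2) :
    (Upsilon κ * flipMat) (a, b) (c, d) =
      (if a = d ∧ b = c then (if a = b then (κ : ℂ) else 1) else 0) +
      (if a = 1 ∧ b = 0 ∧ c = 1 ∧ d = 0 then (κ : ℂ) - (κ : ℂ)⁻¹ else 0) := by
  rw [Matrix.mul_apply, Finset.sum_eq_single (d, c)]
  · fin_cases a <;> fin_cases b <;> fin_cases c <;> fin_cases d <;>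
      simp [Upsilon, toPairs, flipMat, finProdFinEquiv]
  · rintro ⟨x, y⟩ _ h
    have h0 : flipMat (x, y) (c, d) = 0 := by
      simp only [flipMat, Matrix.of_apply]
      exact if_neg h
    rw [h0, mul_zero]
  · simp

theorem spinVec_two {n : ℕ} {i j : Fin n} (ε : Fin n → Fin 2) :
    spinVec ε = spinVec (Function.update (Function.update ε i (ε i)) j (ε j)) := by simp

theorem quad_leg {n : ℕ} (i : Fin n) (A : Matrix (Fin 2) (Fin 2) ℂ) (k : ℂˣ)
    (hd : A.det = -1) (ht : A.trace = k - (k : ℂ)⁻¹) :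
    leg i A * leg i A = ((k : ℂ) - (k : ℂ)⁻¹) • leg i A + 1 := by
  apply end_ext
  intro ε
  simp only [Module.End.mul_apply, leg_spinVec, map_sum, map_smul, LinearMap.add_apply,
    LinearMap.smul_apply, Module.End.one_apply, Function.update_self, Function.update_idem]
  rw [← ht]
  rw [Matrix.det_fin_two] at hd
  rw [Matrix.trace_fin_two]
  simp only [Fin.sum_univ_two]
  have h : spinVec ε = spinVec (Function.update ε i (ε i)) := by simp
  rw [h]
  generalize ε i = x
  fin_cases x
  · simp only [Fin.mk_zero]
    match_scalars
    · linear_combination -hd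
    · ring
  · simp only [Fin.mk_one]
    match_scalars
    · ring
    · linear_combination -hd

theorem quad_leg2 {n : ℕ} {i j : Fin n} (hij : i ≠ j) (κ : ℂˣ) :
    leg2 i j (Upsilon κ * flipMat) * leg2 i j (Upsilon κ * flipMat) =
      ((κ : ℂ) - (κ : ℂ)⁻¹) • leg2 i j (Upsilon κ * flipMat) + 1 := by
  have hκ : (κ : ℂ) ≠ 0 := κ.ne_zero
  apply end_ext
  intro ε
  set F : Fin 2 → Fin 2 → SpinSpace n := fun x y =>
    spinVec (Function.update (Function.update ε i x) j y) with hF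
  have hT : ∀ x y, leg2 i j (Upsilon κ * flipMat) (F x y) =
      ∑ a, ∑ b, (Upsilon κ * flipMat) (a, b) (x, y) • F a b := by
    intro x y
    simp only [hF]
    rw [leg2_spinVec hij]
    simp [Function.update_of_ne hij, Function.update_comm hij]
  have h : spinVec ε = F (ε i) (ε j) := spinVec_two ε
  rw [h]
  generalize ε i = x
  generalize ε j = y
  simp only [Module.End.mul_apply, LinearMap.add_apply, LinearMap.smul_apply,
    Module.End.one_apply]
  fin_cases x <;> fin_cases y <;>
    simp [hT, Fin.sum_univ_two, upsilon_flip] <;> match_scalars <;> field_simp <;> ring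

theorem braid_left {n : ℕ} {i j : Fin n} (hij : i ≠ j) (κ₀ κ ψ₀ : ℂˣ) :
    leg i (KBar κ₀ ψ₀) * leg2 i j (Upsilon κ * flipMat) *
      leg i (KBar κ₀ ψ₀) * leg2 i j (Upsilon κ * flipMat) =
    leg2 i j (Upsilon κ * flipMat) * leg i (KBar κ₀ ψ₀) *
      leg2 i j (Upsilon κ * flipMat) * leg i (KBar κ₀ ψ₀) := by
  have hκ : (κ : ℂ) ≠ 0 := κ.ne_zero
  have hκ0 : (κ₀ : ℂ) ≠ 0 := κ₀.ne_zero
  have hψ : (ψ₀ : ℂ) ≠ 0 := ψ₀.ne_zero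
  apply end_ext
  intro ε
  set F : Fin 2 → Fin 2 → SpinSpace n := fun x y =>
    spinVec (Function.update (Function.update ε i x) j y) with hF
  have hT : ∀ x y, leg2 i j (Upsilon κ * flipMat) (F x y) =
      ∑ a, ∑ b, (Upsilon κ * flipMat) (a, b) (x, y) • F a b := by
    intro x y
    simp only [hF]
    rw [leg2_spinVec hij]
    simp [Function.update_of_ne hij, Function.update_comm hij]
  have hK : ∀ x y, leg i (KBar κ₀ ψ₀) (F x y) = ∑ a, KBar κ₀ ψ₀ a x • F a y := by
    intro x y
    simp only [hF]
    rw [leg_spinVec]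
    simp [Function.update_of_ne hij, Function.update_comm hij]
  have h : spinVec ε = F (ε i) (ε j) := spinVec_two ε
  rw [h]
  generalize ε i = x
  generalize ε j = y
  simp only [Module.End.mul_apply]
  fin_cases x <;> fin_cases y <;>
    simp only [hT, hK, Fin.sum_univ_two, map_add, map_smul, upsilon_flip] <;>
    simp [KBar] <;> match_scalars <;> field_simp <;> ring

theorem braid_right {n : ℕ} {i j : Fin n} (hij : i ≠ j) (κₙ κ ψₙ : ℂˣ) :
    leg2 i j (Upsilon κ * flipMat) * leg j (KMat κₙ ψₙ) *
      leg2 i j (Upsilon κ * flipMat) * leg j (KMat κₙ ψₙ) =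
    leg j (KMat κₙ ψₙ) * leg2 i j (Upsilon κ * flipMat) *
      leg j (KMat κₙ ψₙ) * leg2 i j (Upsilon κ * flipMat) := by
  have hκ : (κ : ℂ) ≠ 0 := κ.ne_zero
  have hκn : (κₙ : ℂ) ≠ 0 := κₙ.ne_zero
  have hψ : (ψₙ : ℂ) ≠ 0 := ψₙ.ne_zero
  apply end_ext
  intro ε
  set F : Fin 2 → Fin 2 → SpinSpace n := fun x y =>
    spinVec (Function.update (Function.update ε i x) j y) with hF
  have hT : ∀ x y, leg2 i j (Upsilon κ * flipMat) (F x y) =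
      ∑ a, ∑ b, (Upsilon κ * flipMat) (a, b) (x, y) • F a b := by
    intro x y
    simp only [hF]
    rw [leg2_spinVec hij]
    simp [Function.update_of_ne hij, Function.update_comm hij]
  have hK : ∀ x y, leg j (KMat κₙ ψₙ) (F x y) = ∑ a, KMat κₙ ψₙ a y • F x a := by
    intro x y
    simp only [hF]
    rw [leg_spinVec]
    simp
  have h : spinVec ε = F (ε i) (ε j) := spinVec_two ε
  rw [h]
  generalize ε i = x
  generalize ε j = y
  simp only [Module.End.mul_apply]
  fin_cases x <;> fin_cases y <;>
    simp only [hT, hK, Fin.sum_univ_two, map_add, map_smul, upsilon_flip] <;>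
    simp [KMat] <;> match_scalars <;> field_simp <;> ring

theorem braid_middle {n : ℕ} {i j k : Fin n} (hij : i ≠ j) (hik : i ≠ k) (hjk : j ≠ k)
    (κ : ℂˣ) :
    leg2 i j (Upsilon κ * flipMat) * leg2 j k (Upsilon κ * flipMat) *
      leg2 i j (Upsilon κ * flipMat) =
    leg2 j k (Upsilon κ * flipMat) * leg2 i j (Upsilon κ * flipMat) *
      leg2 j k (Upsilon κ * flipMat) := by
  have hκ : (κ : ℂ) ≠ 0 := κ.ne_zero
  apply end_ext
  intro ε
  set F : Fin 2 → Fin 2 → Fin 2 → SpinSpace n := fun x y z =>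
    spinVec (Function.update (Function.update (Function.update ε i x) j y) k z) with hF
  have h1 : ∀ x y z, leg2 i j (Upsilon κ * flipMat) (F x y z) =
      ∑ a, ∑ b, (Upsilon κ * flipMat) (a, b) (x, y) • F a b z := by
    intro x y z
    simp only [hF]
    rw [leg2_spinVec hij]
    simp [Function.update_of_ne hij.symm, Function.update_of_ne hik, Function.update_of_ne hjk,
      Function.update_comm hij, Function.update_comm hik, Function.update_comm hjk]
  have h2 : ∀ x y z, leg2 j k (Upsilon κ * flipMat) (F x y z) =
      ∑ a, ∑ b, (Upsilon κ * flipMat) (a, b) (y, z) • F x a b := by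
    intro x y z
    simp only [hF]
    rw [leg2_spinVec hjk]
    simp [Function.update_of_ne hjk, Function.update_comm hjk]
  have h : spinVec ε = F (ε i) (ε j) (ε k) := by simp [hF]
  rw [h]
  generalize ε i = x
  generalize ε j = y
  generalize ε k = z
  simp only [Module.End.mul_apply]
  fin_cases x <;> fin_cases y <;> fin_cases z <;>
    simp [h1, h2, Fin.sum_univ_two, upsilon_flip] <;> match_scalars <;> field_simp <;> ring

theorem quad_spinGen (n : ℕ) (hn : 2 ≤ n) (κ₀ κ κₙ ψ₀ ψₙ : ℂˣ) (j : Fin (n + 1)) :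
    spinGen n hn κ₀ κ κₙ ψ₀ ψₙ j * spinGen n hn κ₀ κ κₙ ψ₀ ψₙ j =
      ((heckeParam n κ₀ κ κₙ j : ℂ) - (heckeParam n κ₀ κ κₙ j : ℂ)⁻¹) •
        spinGen n hn κ₀ κ κₙ ψ₀ ψₙ j + 1 := by
  by_cases h0 : (j : ℕ) = 0
  · simp only [spinGen, heckeParam, h0, if_true, dif_pos]
    apply quad_leg
    · simp [KBar, Matrix.det_fin_two]
    · simp [KBar, Matrix.trace_fin_two]
  by_cases hl : (j : ℕ) = n
  · simp only [spinGen, heckeParam, hl, if_true, dif_pos]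
    rw [if_neg (by omega), dif_neg (by omega)]
    apply quad_leg
    · simp [KMat, Matrix.det_fin_two]
    · simp [KMat, Matrix.trace_fin_two]
  · simp only [spinGen, heckeParam, h0, hl, if_false, dif_neg, not_false_eq_true]
    apply quad_leg2
    intro h
    have := congrArg Fin.val h
    simp only at this
    omega

theorem mul_quad_inv {R : Type*} [Semiring R] [Algebra ℂ R] (x : R) (c : ℂ)
    (h : x * x = c • x + 1) : x * (x + (-c) • 1) = 1 ∧ (x + (-c) • 1) * x = 1 := by
  rw [mul_add, add_mul, h, mul_smul_comm, smul_mul_assoc, mul_one, one_mul,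
    add_right_comm, ← add_smul, add_neg_cancel, zero_smul, zero_add]
  exact ⟨rfl, rfl⟩

theorem quad_factor {R S : Type*} [Semiring R] [Algebra ℂ R] [Ring S] [Algebra ℂ S]
    (f : S →ₐ[ℂ] R) (g : S) (k : ℂˣ)
    (h : f g * f g = ((k : ℂ) - (k : ℂ)⁻¹) • f g + 1) :
    f ((g - algebraMap ℂ S (k : ℂ)) * (g + algebraMap ℂ S ((k⁻¹ : ℂˣ) : ℂ))) = f 0 := by
  have hp : (k : ℂ) ≠ 0 := k.ne_zero
  have e : (g - algebraMap ℂ S (k : ℂ)) * (g + algebraMap ℂ S ((k⁻¹ : ℂˣ) : ℂ)) =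
      g * g + ((-((k : ℂ) - (k : ℂ)⁻¹)) • g + (-1 : ℂ) • 1) := by
    simp only [Algebra.algebraMap_eq_smul_one, Units.val_inv_eq_inv_val, sub_mul, mul_add,
      mul_smul_comm, smul_mul_assoc, mul_one, one_mul]
    match_scalars <;> field_simp
    ring
  rw [e]
  simp only [map_add, map_mul, map_smul, map_one, map_zero, h]
  match_scalars <;> ring

/-- The operator of `T_j` in the spin representation, as an invertible operator. -/
def spinUnit (n : ℕ) (hn : 2 ≤ n) (κ₀ κ κₙ ψ₀ ψₙ : ℂˣ) (j : Fin (n + 1)) :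
    (Module.End ℂ (SpinSpace n))ˣ where
  val := spinGen n hn κ₀ κ κₙ ψ₀ ψₙ j
  inv := spinGen n hn κ₀ κ κₙ ψ₀ ψₙ j +
    (-((heckeParam n κ₀ κ κₙ j : ℂ) - (heckeParam n κ₀ κ κₙ j : ℂ)⁻¹)) • 1
  val_inv := (mul_quad_inv _ _ (quad_spinGen n hn κ₀ κ κₙ ψ₀ ψₙ j)).1
  inv_val := (mul_quad_inv _ _ (quad_spinGen n hn κ₀ κ κₙ ψ₀ ψₙ j)).2

theorem spinGen_zero (n : ℕ) (hn : 2 ≤ n) (κ₀ κ κₙ ψ₀ ψₙ : ℂˣ) :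
    spinGen n hn κ₀ κ κₙ ψ₀ ψₙ (Fin.ofNat (n + 1) 0) = leg ⟨0, by omega⟩ (KBar κ₀ ψ₀) := by
  simp [spinGen]

theorem spinGen_last (n : ℕ) (hn : 2 ≤ n) (κ₀ κ κₙ ψ₀ ψₙ : ℂˣ) :
    spinGen n hn κ₀ κ κₙ ψ₀ ψₙ (Fin.ofNat (n + 1) n) =
      leg ⟨n - 1, by omega⟩ (KMat κₙ ψₙ) := by
  have h : ((Fin.ofNat (n + 1) n : Fin (n + 1)) : ℕ) = n := Nat.mod_eq_of_lt (by omega)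
  rw [spinGen, dif_neg (by omega), dif_pos h]

theorem spinGen_mid (n : ℕ) (hn : 2 ≤ n) (κ₀ κ κₙ ψ₀ ψₙ : ℂˣ) (i : ℕ) (h1 : 1 ≤ i)
    (h2 : i < n) :
    spinGen n hn κ₀ κ κₙ ψ₀ ψₙ (Fin.ofNat (n + 1) i) =
      leg2 ⟨i - 1, by omega⟩ ⟨i, h2⟩ (Upsilon κ * flipMat) := by
  have h : ((Fin.ofNat (n + 1) i : Fin (n + 1)) : ℕ) = i := Nat.mod_eq_of_lt (by omega)
  rw [spinGen, dif_neg (by omega), dif_neg (by omega)]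
  simp only [h]

theorem spin_braidRel (n : ℕ) (hn : 2 ≤ n) (κ₀ κ κₙ ψ₀ ψₙ : ℂˣ) :
    ∀ r ∈ {r | BraidRel n r}, FreeGroup.lift (spinUnit n hn κ₀ κ κₙ ψ₀ ψₙ) r = 1 := by
  rintro r (hr : BraidRel n r)
  induction hr with
  | left =>
    rw [map_mul, map_inv, mul_inv_eq_one]
    simp only [freeGen, map_mul, FreeGroup.lift_apply_of]
    apply Units.ext
    simp only [Units.val_mul, spinUnit, spinGen_zero, spinGen_mid n hn _ _ _ _ _ 1 le_rfl hn]
    exact braid_left (by simp) _ _ _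
  | right =>
    rw [map_mul, map_inv, mul_inv_eq_one]
    simp only [freeGen, map_mul, FreeGroup.lift_apply_of]
    apply Units.ext
    simp only [Units.val_mul, spinUnit, spinGen_last,
      spinGen_mid n hn _ _ _ _ _ (n - 1) (by omega) (by omega)]
    exact braid_right (by simp only [ne_eq, Fin.mk.injEq]; omega) _ _ _
  | middle i h1 h2 =>
    rw [map_mul, map_inv, mul_inv_eq_one]
    simp only [freeGen, map_mul, FreeGroup.lift_apply_of]
    apply Units.ext
    simp only [Units.val_mul, spinUnit,
      spinGen_mid n hn _ _ _ _ _ i (by omega) (by omega),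
      spinGen_mid n hn _ _ _ _ _ (i + 1) (by omega) (by omega)]
    exact braid_middle (by simp only [ne_eq, Fin.mk.injEq]; omega)
      (by simp only [ne_eq, Fin.mk.injEq]; omega) (by simp) _
  | far i j h1 h2 =>
    rw [map_mul, map_inv, mul_inv_eq_one]
    simp only [freeGen, map_mul, FreeGroup.lift_apply_of]
    apply Units.ext
    simp only [Units.val_mul, spinUnit]
    change Commute _ _
    rcases Nat.eq_zero_or_pos i with rfl | hi
    · rw [spinGen_zero]
      rcases Nat.lt_or_eq_of_le h2 with hj | rfl
      · rw [spinGen_mid n hn _ _ _ _ _ j (by omega) hj]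
        exact leg_commute_leg2 (by simp only [ne_eq, Fin.mk.injEq]; omega)
          (by simp only [ne_eq, Fin.mk.injEq]; omega) _ _
      · rw [spinGen_last]
        exact leg_commute (by simp only [ne_eq, Fin.mk.injEq]; omega) _ _
    · rw [spinGen_mid n hn _ _ _ _ _ i hi (by omega)]
      rcases Nat.lt_or_eq_of_le h2 with hj | rfl
      · rw [spinGen_mid n hn _ _ _ _ _ j (by omega) hj]
        exact leg2_commute (by simp only [ne_eq, Fin.mk.injEq]; omega)
          (by simp only [ne_eq, Fin.mk.injEq]; omega)
          (by simp only [ne_eq, Fin.mk.injEq]; omega)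
          (by simp only [ne_eq, Fin.mk.injEq]; omega) _ _
      · rw [spinGen_last]
        exact (leg_commute_leg2 (by simp only [ne_eq, Fin.mk.injEq]; omega)
          (by simp only [ne_eq, Fin.mk.injEq]; omega) _ _).symm

/-- The action of the affine braid group on `(ℂ²)^{⊗ n}` underlying the spin representation. -/
def spinBraid (n : ℕ) (hn : 2 ≤ n) (κ₀ κ κₙ ψ₀ ψₙ : ℂˣ) :
    BraidGroup n →* Module.End ℂ (SpinSpace n) :=
  (Units.coeHom _).comp (PresentedGroup.toGroup (spin_braidRel n hn κ₀ κ κₙ ψ₀ ψₙ))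

theorem spinBraid_sigma (n : ℕ) (hn : 2 ≤ n) (κ₀ κ κₙ ψ₀ ψₙ : ℂˣ) (j : Fin (n + 1)) :
    spinBraid n hn κ₀ κ κₙ ψ₀ ψₙ (sigma n j) = spinGen n hn κ₀ κ κₙ ψ₀ ψₙ j := by
  have hj : Fin.ofNat (n + 1) (j : ℕ) = j := by simp
  simp only [spinBraid, sigma, hj, MonoidHom.comp_apply, PresentedGroup.toGroup.of]
  rfl

/-- The spin representation `ρ_{ψ_0,ψ_n}` of the affine Hecke algebra on `(ℂ²)^{⊗ n}`: the
algebra homomorphism with `T_0 ↦ K̄_1`, `T_i ↦ (Υ ∘ P)_{i,i+1}` for `1 ≤ i < n`, and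
`T_n ↦ K_n`. -/
def spinRep (n : ℕ) (hn : 2 ≤ n) (κ₀ κ κₙ ψ₀ ψₙ : ℂˣ) :
    Hecke n κ₀ κ κₙ →ₐ[ℂ] Module.End ℂ (SpinSpace n) :=
  RingQuot.liftAlgHom ℂ
    ⟨MonoidAlgebra.lift ℂ _ _ (spinBraid n hn κ₀ κ κₙ ψ₀ ψₙ), by
      rintro _ _ ⟨j⟩
      refine quad_factor _ _ _ ?_
      rw [groupAlg, MonoidAlgebra.lift_of, spinBraid_sigma]
      exact quad_spinGen n hn κ₀ κ κₙ ψ₀ ψₙ j⟩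

theorem spinRep_T (n : ℕ) (hn : 2 ≤ n) (κ₀ κ κₙ ψ₀ ψₙ : ℂˣ) (j : Fin (n + 1)) :
    spinRep n hn κ₀ κ κₙ ψ₀ ψₙ (T n κ₀ κ κₙ j) = spinGen n hn κ₀ κ κₙ ψ₀ ψₙ j := by
  simp only [spinRep, T, braidToHecke, groupAlg, MonoidHom.comp_apply, MonoidHom.coe_coe,
    RingQuot.liftAlgHom_mkAlgHom_apply, MonoidAlgebra.lift_of, spinBraid_sigma]

/-! ### The data of the statement -/

/-- The subset `J = {1, …, n-1}` of `{1, …, n}`. -/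
def setJ (n : ℕ) : Set (Fin n) := {i | (i : ℕ) + 1 < n}

/-- `ζ = (ψ_0 ψ_n κ^{n-1}, ψ_0 ψ_n κ^{n-3}, …, ψ_0 ψ_n κ^{1-n})`. -/
def zeta (n : ℕ) (κ ψ₀ ψₙ : ℂˣ) (i : Fin n) : ℂˣ :=
  ψ₀ * ψₙ * κ ^ ((n : ℤ) - 1 - 2 * (i : ℕ))

end

end SpinHecke

/-! The vector v_+ ⊗ ⋯ ⊗ v_+ is a common eigenvector of H_J. Each T_i with 1 ≤ i < n acts on it by
κ. The product T_0 T_1 ⋯ T_n turns the last leg into v_-, carries this v_- to the first leg and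
turns it back, with total factor ψ_0 ψ_n; hence Y_i acts by ζ_i (`spinRep_braidG`). These
eigenvalues give χ_{J,ζ} without any presentation of H_J, and Frobenius reciprocity
(`exists_inducedMap`) yields an intertwiner Φ from M_J(ζ) to the spin representation that sends 1 ⊗
1 to this vector. It is onto: A_p = T_p ⋯ T_n flips the p-th leg of a pure tensor whose legs from p
on are v_+, so every pure tensor is reached (`spinVec_mem_of_stable`).

Injectivity is a dimension count: it suffices that dim M_J(ζ) ≤ 2^n. The vectors A_{p_k} ⋯ A_{p_1}
(1 ⊗ 1) with p_1 < ⋯ < p_k number 2^n, and their span is stable under all T_j (`orbitSpan_stable`),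
so it is the whole cyclic module. Straightening rests on T_i A_p = A_p T_{i-1} for p < i < n
(`mul_tailProd_of_gt`), on A_i A_i = A_{i+1} A_i T_{n-1} (`tailProd_mul_self`), on the quadratic
relations and, for T_0, on 1 ⊗ 1 being an eigenvector of T_0 ⋯ T_n, which only needs the eigenvalue
of Y_1. No PBW basis and no linear independence enter: the surjection onto a space of dimension 2^n
forces equality. -/

namespace SpinHecke

noncomputable section

/-! ### Products `t_p t_{p+1} ⋯ t_n` of braid generators -/

/-- The braid relations of finite type `Bₙ`, for `t_1, …, t_n`, together with the commutation of
`t_0` with `t_2, …, t_n`. -/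
structure IsBraidFamily {R : Type*} [Monoid R] (n : ℕ) (t : ℕ → R) : Prop where
  right : t (n - 1) * t n * t (n - 1) * t n = t n * t (n - 1) * t n * t (n - 1)
  middle : ∀ i, 1 ≤ i → i + 1 < n → t i * t (i + 1) * t i = t (i + 1) * t i * t (i + 1)
  far : ∀ i j, i + 1 < j → j ≤ n → Commute (t i) (t j)

theorem IsBraidFamily.map {R S : Type*} [Monoid R] [Monoid S] {n : ℕ} {t : ℕ → R}
    (ht : IsBraidFamily n t) (f : R →* S) : IsBraidFamily n fun k => f (t k) where
  right := by simpa only [map_mul] using congrArg f ht.right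
  middle i h1 h2 := by simpa only [map_mul] using congrArg f (ht.middle i h1 h2)
  far i j h1 h2 := (ht.far i j h1 h2).map f

/-- The product `t_p t_{p+1} ⋯ t_n`. -/
def tailProd {R : Type*} [Monoid R] (n : ℕ) (t : ℕ → R) (p : ℕ) : R :=
  ((List.range' p (n + 1 - p)).map t).prod

section Monoid

variable {R : Type*} [Monoid R] {n : ℕ} {t : ℕ → R}

theorem tailProd_of_lt {p : ℕ} (hp : n < p) : tailProd n t p = 1 := by
  simp [tailProd, Nat.sub_eq_zero_of_le (Nat.succ_le_of_lt hp)]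

theorem tailProd_eq {p : ℕ} (hp : p ≤ n) : tailProd n t p = t p * tailProd n t (p + 1) := by
  have h : n + 1 - p = (n + 1 - (p + 1)) + 1 := by omega
  rw [tailProd, h, List.range'_succ, List.map_cons, List.prod_cons, tailProd]

theorem tailProd_last : tailProd n t n = t n := by
  rw [tailProd_eq le_rfl, tailProd_of_lt (Nat.lt_succ_self n), mul_one]

theorem IsBraidFamily.commute_tailProd (ht : IsBraidFamily n t) {i p : ℕ} (hi : i + 1 < p) :
    Commute (t i) (tailProd n t p) := by
  refine Commute.list_prod_right _ _ fun x hx => ?_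
  obtain ⟨j, hj, rfl⟩ := List.mem_map.1 hx
  rw [List.mem_range'_1] at hj
  exact ht.far i j (by omega) (by omega)

/-- The factor t_i commutes past t_p, …, t_{i-2}, becomes t_{i-1} through the braid relation with
t_{i-1} t_i, and t_{i-1} commutes with t_{i+1}, …, t_n. -/
theorem IsBraidFamily.mul_tailProd_of_gt (ht : IsBraidFamily n t) {i p : ℕ} (hp : 1 ≤ p)
    (hpi : p < i) (hi : i < n) : t i * tailProd n t p = tailProd n t p * t (i - 1) := by
  obtain ⟨k, rfl⟩ : ∃ k, i = p + 1 + k := ⟨i - (p + 1), by omega⟩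
  induction k generalizing p with
  | zero =>
    rw [tailProd_eq (by omega), tailProd_eq (by omega)]
    calc t (p + 1) * (t p * (t (p + 1) * tailProd n t (p + 1 + 1)))
        = (t (p + 1) * t p * t (p + 1)) * tailProd n t (p + 1 + 1) := by simp only [mul_assoc]
      _ = t p * t (p + 1) * (t p * tailProd n t (p + 1 + 1)) := by
        rw [← ht.middle p hp (by omega)]; simp only [mul_assoc]
      _ = _ := by
        rw [(ht.commute_tailProd (by omega)).eq]
        simp [mul_assoc]
  | succ k ih =>
    have h := ih (p := p + 1) (by omega) (by omega) (by omega)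
    have e : p + 1 + 1 + k = p + 1 + (k + 1) := by omega
    rw [e] at h
    rw [tailProd_eq (by omega : p ≤ n), ← mul_assoc,
      ← (ht.far p (p + 1 + (k + 1)) (by omega) (by omega)).eq, mul_assoc, h, mul_assoc]

/-- For i = n - 1 this is the four-term braid relation; the three-term relations carry it down to
smaller i. On an eigenvector of t_{n-1} it replaces the repeated factor A_i A_i by a scalar multiple
of A_{i+1} A_i, whose indices are in the order allowed in `orbitSpan`. -/
theorem IsBraidFamily.tailProd_mul_self (ht : IsBraidFamily n t) {i : ℕ} (h1 : 1 ≤ i)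
    (hi : i < n) : tailProd n t i * tailProd n t i =
      tailProd n t (i + 1) * tailProd n t i * t (n - 1) := by
  obtain ⟨k, hk⟩ : ∃ k, i + 1 + k = n := ⟨n - (i + 1), by omega⟩
  induction k generalizing i with
  | zero =>
    obtain rfl : n = i + 1 := by omega
    have h := ht.right
    rw [Nat.add_sub_cancel] at h ⊢
    rw [tailProd_eq (by omega : i ≤ i + 1), tailProd_last]
    simpa only [mul_assoc] using h
  | succ k ih =>
    have h := ih (i := i + 1) (by omega) (by omega) (by omega)
    have hC : Commute (t i) (tailProd n t (i + 1 + 1)) := ht.commute_tailProd (by omega)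
    have e1 : tailProd n t i = t i * tailProd n t (i + 1) := tailProd_eq (by omega)
    have e2 : tailProd n t (i + 1) = t (i + 1) * tailProd n t (i + 1 + 1) :=
      tailProd_eq (by omega)
    calc tailProd n t i * tailProd n t i
        = t i * t (i + 1) * (tailProd n t (i + 1 + 1) * t i) * tailProd n t (i + 1) := by
          rw [e1, e2]; simp only [mul_assoc]
      _ = (t i * t (i + 1) * t i) * tailProd n t (i + 1 + 1) * tailProd n t (i + 1) := by
          rw [← hC.eq]; simp only [mul_assoc]
      _ = t (i + 1) * t i * (tailProd n t (i + 1) * tailProd n t (i + 1)) := by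
          rw [ht.middle i h1 (by omega), e2]; simp only [mul_assoc]
      _ = t (i + 1) * (t i * tailProd n t (i + 1 + 1)) * tailProd n t (i + 1) * t (n - 1) := by
          rw [h]; simp only [mul_assoc]
      _ = t (i + 1) * tailProd n t (i + 1 + 1) * (t i * tailProd n t (i + 1)) * t (n - 1) := by
          rw [hC.eq]; simp only [mul_assoc]
      _ = _ := by rw [← e1, ← e2]

end Monoid

/-! ### The span of the vectors `A_{p_k} ⋯ A_{p_1} m`, where `A_p = t_p ⋯ t_n` -/

section Span

variable {V : Type*} [AddCommGroup V] [Module ℂ V]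

/-- The span of the vectors `A_{p_k} ⋯ A_{p_1} m` with `1 ≤ p_1 < ⋯ < p_k ≤ p`, where
`A_q = t_q t_{q+1} ⋯ t_n`. -/
def orbitSpan (n : ℕ) (t : ℕ → Module.End ℂ V) (m : V) : ℕ → Submodule ℂ V
  | 0 => Submodule.span ℂ {m}
  | p + 1 => orbitSpan n t m p ⊔ (orbitSpan n t m p).map (tailProd n t (p + 1))

variable {n : ℕ} {t : ℕ → Module.End ℂ V} {m : V}

theorem orbitSpan_le_succ (p : ℕ) : orbitSpan n t m p ≤ orbitSpan n t m (p + 1) := le_sup_left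

theorem tailProd_mem_orbitSpan {p : ℕ} {x : V} (hx : x ∈ orbitSpan n t m p) :
    tailProd n t (p + 1) x ∈ orbitSpan n t m (p + 1) :=
  Submodule.mem_sup_right (Submodule.mem_map_of_mem hx)

theorem mem_orbitSpan (p : ℕ) : m ∈ orbitSpan n t m p := by
  induction p with
  | zero => exact Submodule.mem_span_singleton_self m
  | succ p ih => exact orbitSpan_le_succ p ih

theorem orbitSpan_succ_le {p : ℕ} {W : Submodule ℂ V} (h0 : ∀ x ∈ orbitSpan n t m p, x ∈ W)
    (h1 : ∀ x ∈ orbitSpan n t m p, tailProd n t (p + 1) x ∈ W) :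
    orbitSpan n t m (p + 1) ≤ W :=
  sup_le h0 (Submodule.map_le_iff_le_comap.2 h1)

/-- Each stage adds one linear image of the preceding stage, so the dimension at most doubles. -/
theorem finrank_orbitSpan_le (p : ℕ) : Module.Finite ℂ (orbitSpan n t m p) ∧
    Module.finrank ℂ (orbitSpan n t m p) ≤ 2 ^ p := by
  induction p with
  | zero =>
    refine ⟨by rw [orbitSpan]; infer_instance, ?_⟩
    exact (finrank_span_le_card (R := ℂ) ({m} : Set V)).trans (by simp)
  | succ p ih =>
    obtain ⟨h, hd⟩ := ih
    have h' : Module.Finite ℂ ((orbitSpan n t m p).map (tailProd n t (p + 1))) := inferInstance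
    refine ⟨Submodule.finite_sup _ _, ?_⟩
    have h1 := Submodule.finrank_add_le_finrank_add_finrank (orbitSpan n t m p)
      ((orbitSpan n t m p).map (tailProd n t (p + 1)))
    have h2 := Submodule.finrank_map_le (tailProd n t (p + 1)) (orbitSpan n t m p)
    rw [orbitSpan, pow_succ]
    omega

variable {κ : ℂ} {c : ℕ → ℂ}

/-- Moving t_i through A_{p+1} lowers its index by one, and i - 1 still exceeds p, so the eigenvalue
κ is inherited from m stage by stage. -/
theorem orbitSpan_eigen (ht : IsBraidFamily n t) (hm : ∀ i, 1 ≤ i → i < n → t i m = κ • m)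
    {p i : ℕ} (hp : p < i) (hi : i < n) {x : V} (hx : x ∈ orbitSpan n t m p) :
    t i x = κ • x := by
  induction p generalizing i x with
  | zero =>
    obtain ⟨a, rfl⟩ := Submodule.mem_span_singleton.1 hx
    rw [map_smul, hm i (by omega) hi, smul_comm]
  | succ p ih =>
    have h := orbitSpan_succ_le (W := LinearMap.ker (t i - κ • (1 : Module.End ℂ V)))
      (fun x hx => ?_) (fun x hx => ?_) hx
    · simpa [sub_eq_zero] using h
    · simpa [sub_eq_zero] using ih (by omega) hi hx
    · have h := congrArg (fun f : Module.End ℂ V => f x)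
        (ht.mul_tailProd_of_gt (by omega : 1 ≤ p + 1) hp hi)
      simp only [Module.End.mul_apply] at h
      simp [h, ih (by omega : p < i - 1) (by omega) hx]

/-- If t_i commutes with the newest operator A_p, that is if i + 1 < p, stability passes from the
previous stage. The remaining case i = p - 1 needs the last two stages to be opened at once. -/
theorem orbitSpan_stable_mid (ht : IsBraidFamily n t)
    (hq : ∀ i, i ≤ n → t i * t i = c i • t i + 1)
    (hm : ∀ i, 1 ≤ i → i < n → t i m = κ • m)
    {p i : ℕ} (h1 : 1 ≤ i) (hi : i < p) (hp : p ≤ n) {x : V} (hx : x ∈ orbitSpan n t m p) :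
    t i x ∈ orbitSpan n t m p := by
  induction p generalizing i x with
  | zero => omega
  | succ p ih =>
    rcases Nat.lt_or_ge i p with hip | hip
    · refine orbitSpan_succ_le (W := (orbitSpan n t m (p + 1)).comap (t i))
        (fun x hx => ?_) (fun x hx => ?_) hx
      · exact orbitSpan_le_succ p (ih h1 hip (by omega) hx)
      · rw [Submodule.mem_comap, ← Module.End.mul_apply, (ht.commute_tailProd (by omega)).eq]
        exact tailProd_mem_orbitSpan (ih h1 hip (by omega) hx)
    · obtain ⟨q, rfl⟩ : ∃ q, i = q + 1 := ⟨i - 1, by omega⟩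
      obtain rfl : p = q + 1 := by omega
      have hE : ∀ x ∈ orbitSpan n t m q, t (q + 1) x = κ • x := fun x hx =>
        orbitSpan_eigen ht hm (by omega) (by omega) hx
      have e : tailProd n t (q + 1) = t (q + 1) * tailProd n t (q + 1 + 1) :=
        tailProd_eq (by omega)
      have mem0 : ∀ x ∈ orbitSpan n t m q, tailProd n t (q + 1) x ∈
          orbitSpan n t m (q + 1 + 1) := fun x hx =>
        orbitSpan_le_succ _ (tailProd_mem_orbitSpan hx)
      -- With S the stage q, stage q + 2 is the sum of S, A_{q+1} S, A_{q+2} S and A_{q+2} A_{q+1}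
      -- S. On these t_{q+1} acts, in turn, by κ; by the quadratic relation, since A_{q+1} begins
      -- with t_{q+1}; by t_{q+1} A_{q+2} = A_{q+1}; and by A_{q+1} A_{q+1} = A_{q+2} A_{q+1}
      -- t_{n-1}, where t_{n-1} is κ on S.
      refine orbitSpan_succ_le (W := (orbitSpan n t m (q + 1 + 1)).comap (t (q + 1)))
        (fun x hx => orbitSpan_succ_le (W := (orbitSpan n t m (q + 1 + 1)).comap (t (q + 1)))
          (fun x hx => ?_) (fun x hx => ?_) hx)
        (fun x hx => orbitSpan_succ_le (W := (orbitSpan n t m (q + 1 + 1)).comap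
          (t (q + 1) * tailProd n t (q + 1 + 1))) (fun x hx => ?_) (fun x hx => ?_) hx) hx
      · rw [Submodule.mem_comap, hE x hx]
        exact Submodule.smul_mem _ _ (orbitSpan_le_succ _ (orbitSpan_le_succ _ hx))
      · rw [Submodule.mem_comap, ← Module.End.mul_apply, e, ← mul_assoc, hq _ (by omega),
          add_mul, one_mul, smul_mul_assoc, ← e]
        exact Submodule.add_mem _ (Submodule.smul_mem _ _ (mem0 x hx))
          (tailProd_mem_orbitSpan (orbitSpan_le_succ _ hx))
      · rw [Submodule.mem_comap, ← e]
        exact mem0 x hx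
      · have h : (t (q + 1) * tailProd n t (q + 1 + 1)) (tailProd n t (q + 1) x) =
            tailProd n t (q + 1 + 1) (tailProd n t (q + 1) (t (n - 1) x)) := by
          rw [← e, ← Module.End.mul_apply, ht.tailProd_mul_self h1 (by omega)]
          rfl
        rw [Submodule.mem_comap, h,
          orbitSpan_eigen ht hm (by omega : q < n - 1) (by omega) hx, map_smul, map_smul]
        exact Submodule.smul_mem _ _ (tailProd_mem_orbitSpan (tailProd_mem_orbitSpan hx))

/-- As A_n = t_n, the last stage is S + t_n S, which the quadratic relation makes stable. -/
theorem orbitSpan_stable_last (hn : 1 ≤ n) (hq : t n * t n = c n • t n + 1) {x : V}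
    (hx : x ∈ orbitSpan n t m n) : t n x ∈ orbitSpan n t m n := by
  obtain ⟨q, rfl⟩ : ∃ q, n = q + 1 := ⟨n - 1, by omega⟩
  have key : ∀ x ∈ orbitSpan (q + 1) t m q, t (q + 1) x ∈ orbitSpan (q + 1) t m (q + 1) := by
    intro x hx
    rw [← tailProd_last (n := q + 1) (t := t)]
    exact tailProd_mem_orbitSpan hx
  refine orbitSpan_succ_le (W := (orbitSpan (q + 1) t m (q + 1)).comap (t (q + 1))) key
    (fun x hx => ?_) hx
  rw [Submodule.mem_comap, tailProd_last, ← Module.End.mul_apply, hq]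
  exact Submodule.add_mem _ (Submodule.smul_mem _ _ (key x hx)) (orbitSpan_le_succ _ hx)

/-- On stage 1, spanned by m and A_1 m, the operator t_0 sends A_1 m to z m, and the quadratic
relation then determines t_0 m. Later stages only add A_p with p ≥ 2, which commute with t_0. -/
theorem orbitSpan_stable_zero (ht : IsBraidFamily n t) (hq : t 0 * t 0 = c 0 • t 0 + 1)
    {z : ℂ} (hz : z ≠ 0) (h0 : tailProd n t 0 m = z • m)
    {p : ℕ} (hp : 1 ≤ p) {x : V} (hx : x ∈ orbitSpan n t m p) :
    t 0 x ∈ orbitSpan n t m p := by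
  induction p, hp using Nat.le_induction generalizing x with
  | base =>
    have e : t 0 (tailProd n t 1 m) = z • m := by
      rw [← h0, tailProd_eq (Nat.zero_le n)]; rfl
    -- Obtained by applying the quadratic relation to A_1 m and dividing by z.
    have hm : t 0 m = c 0 • m + z⁻¹ • tailProd n t 1 m := by
      have h := congrArg (fun f : Module.End ℂ V => f (tailProd n t 1 m)) hq
      simp only [Module.End.mul_apply, LinearMap.add_apply, LinearMap.smul_apply,
        Module.End.one_apply, e, map_smul] at h
      have h' := congrArg (z⁻¹ • ·) h
      simp only [smul_add, smul_smul, inv_mul_cancel₀ hz, one_smul] at h'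
      rw [h', mul_comm (c 0) z, inv_mul_cancel_left₀ hz]
    have m0 : tailProd n t 1 m ∈ orbitSpan n t m 1 :=
      tailProd_mem_orbitSpan (p := 0) (mem_orbitSpan 0)
    refine orbitSpan_succ_le (p := 0) (W := (orbitSpan n t m 1).comap (t 0))
      (fun x hx => ?_) (fun x hx => ?_) hx
    · obtain ⟨a, rfl⟩ := Submodule.mem_span_singleton.1 hx
      rw [Submodule.mem_comap, map_smul, hm]
      exact Submodule.smul_mem _ _ (Submodule.add_mem _
        (Submodule.smul_mem _ _ (mem_orbitSpan 1)) (Submodule.smul_mem _ _ m0))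
    · obtain ⟨a, rfl⟩ := Submodule.mem_span_singleton.1 hx
      rw [Submodule.mem_comap, map_smul, map_smul, e]
      exact Submodule.smul_mem _ _ (Submodule.smul_mem _ _ (mem_orbitSpan 1))
  | succ p hp ih =>
    refine orbitSpan_succ_le (W := (orbitSpan n t m (p + 1)).comap (t 0))
      (fun x hx => orbitSpan_le_succ p (ih hx)) (fun x hx => ?_) hx
    rw [Submodule.mem_comap, ← Module.End.mul_apply, (ht.commute_tailProd (by omega)).eq]
    exact tailProd_mem_orbitSpan (ih hx)

/-- If `t_i m = κ m` for `1 ≤ i < n` and `m` is an eigenvector of `t_0 t_1 ⋯ t_n`, then the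
span of the vectors `A_{p_k} ⋯ A_{p_1} m` is stable under `t_0, …, t_n`. -/
theorem orbitSpan_stable (hn : 1 ≤ n) (ht : IsBraidFamily n t)
    (hq : ∀ i, i ≤ n → t i * t i = c i • t i + 1)
    (hm : ∀ i, 1 ≤ i → i < n → t i m = κ • m)
    {z : ℂ} (hz : z ≠ 0) (h0 : tailProd n t 0 m = z • m) {i : ℕ} (hi : i ≤ n) {x : V}
    (hx : x ∈ orbitSpan n t m n) : t i x ∈ orbitSpan n t m n := by
  rcases Nat.eq_zero_or_pos i with rfl | h1
  · exact orbitSpan_stable_zero ht (hq 0 hi) hz h0 hn hx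
  rcases Nat.lt_or_eq_of_le hi with h | rfl
  · exact orbitSpan_stable_mid ht hq hm h1 h le_rfl hx
  · exact orbitSpan_stable_last hn (hq i le_rfl) hx

end Span

/-! ### Relations in the braid group and the affine Hecke algebra -/

theorem freeGen_mk (n k : ℕ) :
    PresentedGroup.mk {r | BraidRel n r} (freeGen n k) = sigma n k := rfl

theorem mk_eq_of_braidRel {n : ℕ} {x y : FreeGroup (Fin (n + 1))} (h : BraidRel n (x * y⁻¹)) :
    PresentedGroup.mk {r | BraidRel n r} x = PresentedGroup.mk {r | BraidRel n r} y :=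
  PresentedGroup.mk_eq_mk_of_mul_inv_mem (rels := {r | BraidRel n r}) h

theorem isBraidFamily_sigma (n : ℕ) : IsBraidFamily n (sigma n) where
  right := by simpa only [map_mul, freeGen_mk] using mk_eq_of_braidRel (BraidRel.right (n := n))
  middle i h1 h2 := by
    simpa only [map_mul, freeGen_mk] using mk_eq_of_braidRel (BraidRel.middle i h1 h2)
  far i j h1 h2 := by
    change _ * _ = _ * _
    simpa only [map_mul, freeGen_mk] using mk_eq_of_braidRel (BraidRel.far i j h1 h2)

theorem sigma_val {n : ℕ} (j : Fin (n + 1)) : sigma n (j : ℕ) = PresentedGroup.of j := by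
  simp [sigma]

theorem ofNat_val {n k : ℕ} (hk : k ≤ n) : ((Fin.ofNat (n + 1) k : Fin (n + 1)) : ℕ) = k :=
  Nat.mod_eq_of_lt (by omega)

theorem braidToHecke_quad (n : ℕ) (κ₀ κ κₙ : ℂˣ) {k : ℕ} (hk : k ≤ n) :
    braidToHecke n κ₀ κ κₙ (sigma n k) * braidToHecke n κ₀ κ κₙ (sigma n k) =
      ((heckeParam n κ₀ κ κₙ (Fin.ofNat (n + 1) k) : ℂ) -
        (heckeParam n κ₀ κ κₙ (Fin.ofNat (n + 1) k) : ℂ)⁻¹) •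
          braidToHecke n κ₀ κ κₙ (sigma n k) + 1 := by
  have h := RingQuot.mkAlgHom_rel ℂ (HeckeRel.quad (κ₀ := κ₀) (κ := κ) (κₙ := κₙ)
    (Fin.ofNat (n + 1) k))
  rw [ofNat_val hk] at h
  simp only [map_mul, map_sub, map_add, map_zero, AlgHom.commutes] at h
  change (braidToHecke n κ₀ κ κₙ (sigma n k) - _) * (braidToHecke n κ₀ κ κₙ (sigma n k) + _) = 0
    at h
  have hp := (heckeParam n κ₀ κ κₙ (Fin.ofNat (n + 1) k)).ne_zero
  generalize braidToHecke n κ₀ κ κₙ (sigma n k) = g at h ⊢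
  generalize heckeParam n κ₀ κ κₙ (Fin.ofNat (n + 1) k) = a at h hp ⊢
  rw [← sub_eq_zero, ← h]
  simp only [Algebra.algebraMap_eq_smul_one, Units.val_inv_eq_inv_val, sub_mul, mul_add,
    mul_smul_comm, smul_mul_assoc, mul_one, one_mul]
  match_scalars <;> field_simp
  ring

/-- The quadratic relation gives T_j⁻¹ = T_j - (κ_j - κ_j⁻¹), so inverses cost nothing; then S
contains the image of every braid, and braids span the group algebra. -/
theorem subalgebra_eq_top_of_generators (n : ℕ) (κ₀ κ κₙ : ℂˣ) (S : Subalgebra ℂ (Hecke n κ₀ κ κₙ))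
    (h : ∀ j, j ≤ n → braidToHecke n κ₀ κ κₙ (sigma n j) ∈ S) : S = ⊤ := by
  have hinv : ∀ j, j ≤ n → braidToHecke n κ₀ κ κₙ (sigma n j)⁻¹ ∈ S := by
    intro j hj
    have e := (mul_quad_inv _ _ (braidToHecke_quad n κ₀ κ κₙ hj)).2
    have e' : braidToHecke n κ₀ κ κₙ (sigma n j) * braidToHecke n κ₀ κ κₙ (sigma n j)⁻¹ = 1 := by
      rw [← map_mul, mul_inv_cancel, map_one]
    rw [← left_inv_eq_right_inv e e']
    exact S.add_mem (h j hj) (S.smul_mem S.one_mem _)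
  have hB : ∀ b, braidToHecke n κ₀ κ κₙ b ∈ S := by
    intro b
    have hb : b ∈ Subgroup.closure (Set.range (PresentedGroup.of (rels := {r | BraidRel n r}))) := by
      rw [PresentedGroup.closure_range_of]; trivial
    induction hb using Subgroup.closure_induction_left with
    | one => rw [map_one]; exact S.one_mem
    | mul_left x hx y _ hy =>
      obtain ⟨j, rfl⟩ := hx
      rw [map_mul, ← sigma_val]
      exact S.mul_mem (h j (by omega)) hy
    | inv_mul_cancel x hx y _ hy =>
      obtain ⟨j, rfl⟩ := hx
      rw [map_mul, ← sigma_val]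
      exact S.mul_mem (hinv j (by omega)) hy
  rw [eq_top_iff]
  rintro x -
  obtain ⟨y, rfl⟩ := RingQuot.mkAlgHom_surjective ℂ (HeckeRel n κ₀ κ κₙ) x
  induction y using MonoidAlgebra.induction_on with
  | of b => exact hB b
  | add f g hf hg => rw [map_add]; exact S.add_mem hf hg
  | smul r f hf => rw [map_smul]; exact S.smul_mem hf r

/-- Submodules stable under all `T_j` are stable under the affine Hecke algebra. -/
theorem stable_of_generators {n : ℕ} {κ₀ κ κₙ : ℂˣ} {V : Type*} [AddCommGroup V] [Module ℂ V]
    (π : Hecke n κ₀ κ κₙ →ₐ[ℂ] Module.End ℂ V) (W : Submodule ℂ V)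
    (h : ∀ j, j ≤ n → ∀ v ∈ W, π (braidToHecke n κ₀ κ κₙ (sigma n j)) v ∈ W)
    (a : Hecke n κ₀ κ κₙ) {v : V} (hv : v ∈ W) : π a v ∈ W := by
  let S : Subalgebra ℂ (Hecke n κ₀ κ κₙ) :=
    { carrier := {a | ∀ v ∈ W, π a v ∈ W}
      mul_mem' := fun {a b} ha hb v hv => by
        rw [map_mul]; exact ha _ (hb _ hv)
      add_mem' := fun {a b} ha hb v hv => by
        rw [map_add]; exact W.add_mem (ha _ hv) (hb _ hv)
      algebraMap_mem' := fun r v hv => by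
        rw [AlgHom.commutes]
        exact W.smul_mem r hv }
  have hS : S = ⊤ := subalgebra_eq_top_of_generators n κ₀ κ κₙ S h
  have ha : a ∈ S := hS ▸ Algebra.mem_top
  exact ha v hv

/-! ### Action of the elements Y^λ on common eigenvectors -/

theorem tailProd_zero_eq {R : Type*} [Monoid R] (n : ℕ) (t : ℕ → R) :
    tailProd n t 0 = ((List.range (n + 1)).map t).prod := by
  rw [tailProd, List.range_eq_range', Nat.sub_zero]

theorem list_prod_apply_eigen {V : Type*} [AddCommGroup V] [Module ℂ V]
    {f : ℕ → Module.End ℂ V} {m : V} {a : ℂ} (l : List ℕ) (h : ∀ k ∈ l, f k m = a • m) :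
    (l.map f).prod m = a ^ l.length • m := by
  induction l with
  | nil => simp
  | cons x l ih =>
    rw [List.map_cons, List.prod_cons, Module.End.mul_apply,
      ih fun k hk => h k (List.mem_cons_of_mem _ hk), map_smul,
      h x List.mem_cons_self, smul_smul, List.length_cons, pow_succ]

/-- The action of the element `braidG n i` on a vector with `σ_k m = κ m` for `1 ≤ k < n`. -/
theorem braidG_apply {n : ℕ} {V : Type*} [AddCommGroup V] [Module ℂ V]
    (π : BraidGroup n →* Module.End ℂ V) {m : V} {κ : ℂˣ}
    (hm : ∀ k, 1 ≤ k → k < n → π (sigma n k) m = (κ : ℂ) • m) (i : Fin n) :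
    π (braidG n i) m = ((κ ^ (n - 1 - (i : ℕ)) : ℂˣ) : ℂ) •
      (((List.range i).reverse.map fun k => π (sigma n (k + 1))⁻¹).prod
        (tailProd n (fun k => π (sigma n k)) 0 m)) := by
  have h := list_prod_apply_eigen (f := fun k => π (sigma n k)) (m := m) (a := κ)
    (List.range' (i + 1) (n - 1 - i)).reverse fun k hk => by
      rw [List.mem_reverse, List.mem_range'_1] at hk
      exact hm k (by omega) (by omega)
  rw [List.length_reverse, List.length_range'] at h
  simp only [braidG, map_mul, map_list_prod, List.map_map, Function.comp_def,
    Module.End.mul_apply]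
  rw [h, map_smul, map_smul, tailProd_zero_eq]
  simp

/-- For Y_1 there are no inverse factors: Y_1 = T_0 ⋯ T_n · T_{n-1} ⋯ T_1, and the right-hand part
scales m by κ^{n-1}. This supplies the eigenvalue hypothesis of `orbitSpan_stable`. -/
theorem tailProd_apply_of_braidG {n : ℕ} (hn : 0 < n) {V : Type*} [AddCommGroup V] [Module ℂ V]
    (π : BraidGroup n →* Module.End ℂ V) {m : V} {κ z : ℂˣ}
    (hm : ∀ k, 1 ≤ k → k < n → π (sigma n k) m = (κ : ℂ) • m)
    (h : π (braidG n ⟨0, hn⟩) m = (z : ℂ) • m) :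
    tailProd n (fun k => π (sigma n k)) 0 m = (((κ ^ (n - 1))⁻¹ * z : ℂˣ) : ℂ) • m := by
  rw [Units.val_mul, mul_smul, ← h, braidG_apply π hm, smul_smul, ← Units.val_mul]
  simp

theorem inv_apply_eigen {G V : Type*} [Group G] [AddCommGroup V] [Module ℂ V]
    (π : G →* Module.End ℂ V) {g : G} {m : V} {a : ℂˣ} (h : π g m = (a : ℂ) • m) :
    π g⁻¹ m = ((a⁻¹ : ℂˣ) : ℂ) • m := by
  have e : π g⁻¹ (π g m) = m := by
    rw [← Module.End.mul_apply, ← map_mul, inv_mul_cancel, map_one, Module.End.one_apply]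
  rw [h, map_smul] at e
  conv_rhs => rw [← e]
  rw [smul_smul, ← Units.val_mul, inv_mul_cancel, Units.val_one, one_smul]

theorem zpow_apply_eigen {G V : Type*} [Group G] [AddCommGroup V] [Module ℂ V]
    (π : G →* Module.End ℂ V) {g : G} {m : V} {a : ℂˣ} (h : π g m = (a : ℂ) • m) (l : ℤ) :
    π (g ^ l) m = ((a ^ l : ℂˣ) : ℂ) • m := by
  have hpow : ∀ k : ℕ, π (g ^ k) m = ((a ^ k : ℂˣ) : ℂ) • m := by
    intro k
    induction k with
    | zero => simp
    | succ k ih =>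
      rw [pow_succ, map_mul, Module.End.mul_apply, h, map_smul, ih, smul_smul, pow_succ,
        Units.val_mul, mul_comm (a : ℂ)]
  cases l with
  | ofNat k => simpa using hpow k
  | negSucc k =>
    rw [zpow_negSucc, zpow_negSucc]
    exact inv_apply_eigen π (hpow (k + 1))

theorem list_ofFn_prod_apply_eigen {G V : Type*} [Group G] [AddCommGroup V] [Module ℂ V]
    (π : G →* Module.End ℂ V) {m : V} {n : ℕ} (g : Fin n → G) (a : Fin n → ℂˣ)
    (h : ∀ i, π (g i) m = (a i : ℂ) • m) :
    π (List.ofFn g).prod m = ((∏ i, a i : ℂˣ) : ℂ) • m := by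
  induction n with
  | zero => simp
  | succ n ih =>
    rw [List.ofFn_succ, List.prod_cons, map_mul, Module.End.mul_apply,
      ih _ (fun i => a i.succ) fun i => h i.succ, map_smul, h 0, smul_smul, Fin.prod_univ_succ,
      Units.val_mul, mul_comm (a 0 : ℂ)]

/-- A principal character is prescribed on the Y^λ, so single Y_i are recovered by taking λ to be a
unit vector. -/
theorem braidGPow_single {n : ℕ} (i : Fin n) : braidGPow n (Pi.single i 1) = braidG n i := by
  -- Stated for an arbitrary group, so that the induction on the length does not change the braid
  -- group.
  have key : ∀ (m : ℕ) (G : Type) [Group G] (g : Fin m → G) (i : Fin m),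
      (List.ofFn fun j => g j ^ (Pi.single i 1 : Fin m → ℤ) j).prod = g i := by
    intro m G _ g i
    induction m with
    | zero => exact i.elim0
    | succ m ih =>
      rw [List.ofFn_succ, List.prod_cons]
      refine Fin.cases ?_ (fun i => ?_) i
      · rw [List.prod_eq_one]
        · simp
        · intro x hx
          obtain ⟨j, rfl⟩ := (List.mem_ofFn' _ _).1 hx
          simp
      · have h := ih (fun j => g j.succ) i
        have e : ∀ j : Fin m, (Pi.single i.succ 1 : Fin (m + 1) → ℤ) j.succ =
            (Pi.single i 1 : Fin m → ℤ) j := fun j => by simp [Pi.single_apply]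
        simp only [e, h]
        simp
  exact key n (BraidGroup n) (braidG n) i

/-! ### Characters and induced modules -/

section InducedModule

variable {A : Type*} [Ring A] [Algebra ℂ A] {V : Type*} [AddCommGroup V] [Module ℂ V]

/-- A common eigenvector of the generators of a subalgebra defines a character. -/
theorem exists_char_of_eigenvector (ρ : A →ₐ[ℂ] Module.End ℂ V) {s : Set A} {v : V} (hv : v ≠ 0)
    (h : ∀ x ∈ s, ∃ c : ℂ, ρ x v = c • v) :
    ∃ χ : Algebra.adjoin ℂ s →ₐ[ℂ] ℂ, ∀ b : Algebra.adjoin ℂ s, ρ b v = χ b • v := by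
  have hall : ∀ b : Algebra.adjoin ℂ s, ∃ c : ℂ, ρ b v = c • v := by
    rintro ⟨b, hb⟩
    induction hb using Algebra.adjoin_induction with
    | mem x hx => exact h x hx
    | algebraMap r => exact ⟨r, by simp⟩
    | add x y _ _ hx hy =>
      obtain ⟨c, hc⟩ := hx
      obtain ⟨d, hd⟩ := hy
      exact ⟨c + d, by simp_all [add_smul]⟩
    | mul x y _ _ hx hy =>
      obtain ⟨c, hc⟩ := hx
      obtain ⟨d, hd⟩ := hy
      exact ⟨d * c, by simp_all [mul_smul]⟩
  choose χ hχ using hall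
  have inj : ∀ {c d : ℂ}, c • v = d • v → c = d := fun e => smul_left_injective ℂ hv e
  refine ⟨{ toFun := χ
            map_one' := inj (by rw [← hχ]; simp)
            map_mul' := fun x y => inj (by
              rw [← hχ, mul_comm, mul_smul, ← hχ x, ← map_smul, ← hχ y]; simp)
            map_zero' := inj (by rw [← hχ]; simp)
            map_add' := fun x y => inj (by rw [← hχ, add_smul, ← hχ, ← hχ]; simp)
            commutes' := fun r => inj (by
              rw [← hχ, Subalgebra.coe_algebraMap, AlgHom.commutes]; simp) }, hχ⟩

variable (B : Subalgebra ℂ A) (χ : B →ₐ[ℂ] ℂ)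

/-- The canonical generator `1 ⊗ 1` of the induced module. -/
def inducedVec : Induced B χ := Submodule.Quotient.mk (1 ⊗ₜ[ℂ] 1)

theorem inducedRep_mk (a : A) (x : A ⊗[ℂ] ℂ) :
    inducedRep B χ a (Submodule.Quotient.mk x) = Submodule.Quotient.mk (a • x) := rfl

theorem inducedRep_inducedVec (b : B) :
    inducedRep B χ b (inducedVec B χ) = χ b • inducedVec B χ := by
  rw [inducedVec, inducedRep_mk, ← Submodule.Quotient.mk_smul, Submodule.Quotient.eq]
  refine Submodule.subset_span ⟨1, b, 1, ?_⟩
  rw [TensorProduct.smul_tmul', smul_eq_mul, mul_one, one_mul, mul_one, ← TensorProduct.tmul_smul,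
    smul_eq_mul, mul_one]

theorem exists_inducedRep_inducedVec (x : Induced B χ) :
    ∃ a : A, inducedRep B χ a (inducedVec B χ) = x := by
  obtain ⟨y, rfl⟩ := Submodule.Quotient.mk_surjective _ x
  induction y using TensorProduct.induction_on with
  | zero => exact ⟨0, by simp⟩
  | tmul a z =>
    refine ⟨z • a, ?_⟩
    rw [inducedVec, inducedRep_mk, TensorProduct.smul_tmul', smul_eq_mul, mul_one,
      TensorProduct.smul_tmul, smul_eq_mul, mul_one]
  | add x y hx hy =>
    obtain ⟨a, ha⟩ := hx
    obtain ⟨b, hb⟩ := hy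
    exact ⟨a + b, by rw [map_add, LinearMap.add_apply, ha, hb, Submodule.Quotient.mk_add]⟩

/-- Frobenius reciprocity: an eigenvector with character `χ` in a representation of `A` defines an
intertwiner from the module induced from `χ`. -/
theorem exists_inducedMap (ρ : A →ₐ[ℂ] Module.End ℂ V) {v : V} (hv : ∀ b : B, ρ b v = χ b • v) :
    ∃ Φ : Induced B χ →ₗ[ℂ] V, (∀ a x, Φ (inducedRep B χ a x) = ρ a (Φ x)) ∧
      Φ (inducedVec B χ) = v := by
  let L : A ⊗[ℂ] ℂ →ₗ[ℂ] V :=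
    (LinearMap.applyₗ v ∘ₗ ρ.toLinearMap) ∘ₗ (TensorProduct.rid ℂ A).toLinearMap
  have hL : ∀ a z, L (a ⊗ₜ z) = z • ρ a v := fun a z => by simp [L]
  have hLs : ∀ (a : A) x, L (a • x) = ρ a (L x) := by
    intro a x
    induction x using TensorProduct.induction_on with
    | zero => simp
    | tmul b z => simp [TensorProduct.smul_tmul', hL]
    | add x y hx hy => rw [smul_add, map_add, hx, hy, map_add, map_add]
  -- The relations span an A-submodule while L is only ℂ-linear; `hLs` handles the multiples by A in
  -- the span induction.
  have hker : (inducedRel B χ).restrictScalars ℂ ≤ LinearMap.ker L := by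
    intro x hx
    rw [Submodule.restrictScalars_mem] at hx
    rw [LinearMap.mem_ker]
    induction hx using Submodule.span_induction with
    | mem x hx =>
      obtain ⟨a, b, z, rfl⟩ := hx
      rw [map_sub, hL, hL, map_mul, Module.End.mul_apply, hv, map_smul, smul_smul,
        mul_comm z, sub_self]
    | zero => simp
    | add x y _ _ hx hy => rw [map_add, hx, hy, add_zero]
    | smul a x _ hx => rw [hLs, hx, map_zero]
  refine ⟨((inducedRel B χ).restrictScalars ℂ).liftQ L hker ∘ₗ
    (Submodule.Quotient.restrictScalarsEquiv ℂ (inducedRel B χ)).symm.toLinearMap, ?_, ?_⟩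
  · intro a x
    obtain ⟨y, rfl⟩ := Submodule.Quotient.mk_surjective _ x
    exact hLs a y
  · change L (1 ⊗ₜ 1) = v
    simp [hL]

end InducedModule

/-! ### Highest weight vectors in the spin representation -/

section Spin

variable (n : ℕ) (hn : 2 ≤ n) (κ₀ κ κₙ ψ₀ ψₙ : ℂˣ)

/-- The operator by which `T_k` acts in the spin representation, for `0 ≤ k ≤ n`. -/
def spinOp (k : ℕ) : Module.End ℂ (SpinSpace n) :=
  spinRep n hn κ₀ κ κₙ ψ₀ ψₙ (braidToHecke n κ₀ κ κₙ (sigma n k))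

theorem spinOp_eq {k : ℕ} (hk : k ≤ n) :
    spinOp n hn κ₀ κ κₙ ψ₀ ψₙ k = spinGen n hn κ₀ κ κₙ ψ₀ ψₙ (Fin.ofNat (n + 1) k) := by
  rw [← spinRep_T, T, ofNat_val hk, spinOp]

theorem spinOp_last {ε : Fin n → Fin 2} (h : ε ⟨n - 1, by omega⟩ = 0) :
    spinOp n hn κ₀ κ κₙ ψ₀ ψₙ n (spinVec ε) =
      (ψₙ : ℂ) • spinVec (Function.update ε ⟨n - 1, by omega⟩ 1) := by
  rw [spinOp_eq _ _ _ _ _ _ _ le_rfl, spinGen_last, leg_spinVec, h]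
  simp [KMat]

theorem spinOp_zero {ε : Fin n → Fin 2} (h : ε ⟨0, by omega⟩ = 0) :
    spinOp n hn κ₀ κ κₙ ψ₀ ψₙ 0 (spinVec (Function.update ε ⟨0, by omega⟩ 1)) =
      (ψ₀ : ℂ) • spinVec ε := by
  rw [spinOp_eq _ _ _ _ _ _ _ (Nat.zero_le n), spinGen_zero, leg_spinVec]
  have e : Function.update ε ⟨0, by omega⟩ 0 = ε := by rw [← h, Function.update_eq_self]
  simp [KBar, e]

theorem spinOp_mid_eigen {k : ℕ} (h1 : 1 ≤ k) (hk : k < n) {ε : Fin n → Fin 2}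
    (ha : ε ⟨k - 1, by omega⟩ = 0) (hb : ε ⟨k, hk⟩ = 0) :
    spinOp n hn κ₀ κ κₙ ψ₀ ψₙ k (spinVec ε) = (κ : ℂ) • spinVec ε := by
  have hne : (⟨k - 1, by omega⟩ : Fin n) ≠ ⟨k, hk⟩ := by
    simp only [ne_eq, Fin.mk.injEq]; omega
  rw [spinOp_eq _ _ _ _ _ _ _ hk.le, spinGen_mid _ _ _ _ _ _ _ k h1 hk, leg2_spinVec hne]
  have e : spinVec ε = spinVec
      (Function.update (Function.update ε ⟨k - 1, by omega⟩ 0) ⟨k, hk⟩ 0) := by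
    conv_rhs => rw [← ha, Function.update_eq_self, ha, ← hb, Function.update_eq_self]
  simp [ha, hb, upsilon_flip, ← e]

/-- The correction term κ - κ⁻¹ of Υ ∘ P occurs only on v_- ⊗ v_+, so a v_- moves left past a v_+
with coefficient 1. -/
theorem spinOp_mid_move {k : ℕ} (h1 : 1 ≤ k) (hk : k < n) {ε : Fin n → Fin 2}
    (ha : ε ⟨k - 1, by omega⟩ = 0) (hb : ε ⟨k, hk⟩ = 0) :
    spinOp n hn κ₀ κ κₙ ψ₀ ψₙ k (spinVec (Function.update ε ⟨k, hk⟩ 1)) =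
      spinVec (Function.update ε ⟨k - 1, by omega⟩ 1) := by
  have hne : (⟨k - 1, by omega⟩ : Fin n) ≠ ⟨k, hk⟩ := by
    simp only [ne_eq, Fin.mk.injEq]; omega
  rw [spinOp_eq _ _ _ _ _ _ _ hk.le, spinGen_mid _ _ _ _ _ _ _ k h1 hk, leg2_spinVec hne]
  have e : Function.update (Function.update (Function.update ε ⟨k, hk⟩ 1) ⟨k - 1, by omega⟩ 1)
      ⟨k, hk⟩ 0 = Function.update ε ⟨k - 1, by omega⟩ 1 := by
    rw [Function.update_comm hne.symm, Function.update_idem, ← hb, Function.update_comm hne,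
      Function.update_eq_self]
  simp [ha, upsilon_flip, Function.update_of_ne hne, e]

/-- T_n creates a v_- in the last leg with factor ψ_n, and T_{n-1}, …, T_{p+1} carry it leftwards.
Legs are counted from 0, so T_{p+1} acts on legs p and p + 1 and the v_- stops in leg p. -/
theorem tailProd_spinVec {p : ℕ} (hp : p < n) {ε : Fin n → Fin 2}
    (h : ∀ k : Fin n, p ≤ k → ε k = 0) :
    tailProd n (spinOp n hn κ₀ κ κₙ ψ₀ ψₙ) (p + 1) (spinVec ε) =
      (ψₙ : ℂ) • spinVec (Function.update ε ⟨p, hp⟩ 1) := by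
  obtain ⟨k, hk⟩ : ∃ k, p + 1 + k = n := ⟨n - (p + 1), by omega⟩
  induction k generalizing p with
  | zero =>
    obtain rfl : n = p + 1 := by omega
    rw [tailProd_last]
    exact spinOp_last _ hn _ _ _ _ _ (h _ (by simp))
  | succ k ih =>
    rw [tailProd_eq (by omega), Module.End.mul_apply,
      ih (p := p + 1) (by omega) (fun k hk => h k (by omega)) (by omega), map_smul]
    congr 1
    exact spinOp_mid_move n hn κ₀ κ κₙ ψ₀ ψₙ (by omega) (by omega) (h _ (by simp)) (h _ (by simp))

/-- A_1 brings a v_- to the first leg with factor ψ_n, and T_0 turns it back into v_+ with factor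
ψ_0. -/
theorem tailProd_zero_spinVec :
    tailProd n (spinOp n hn κ₀ κ κₙ ψ₀ ψₙ) 0 (spinVec 0) =
      ((ψ₀ * ψₙ : ℂˣ) : ℂ) • spinVec 0 := by
  rw [tailProd_eq (Nat.zero_le n), Module.End.mul_apply,
    tailProd_spinVec n hn κ₀ κ κₙ ψ₀ ψₙ (p := 0) (ε := 0) (by omega) (fun _ _ => rfl), map_smul,
    spinOp_zero n hn κ₀ κ κₙ ψ₀ ψₙ rfl, smul_smul, Units.val_mul, mul_comm]

theorem map_tailProd {R S : Type*} [Monoid R] [Monoid S] (f : R →* S) (t : ℕ → R) (p : ℕ) :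
    f (tailProd n t p) = tailProd n (fun k => f (t k)) p := by
  simp only [tailProd, map_list_prod, List.map_map, Function.comp_def]

/-- The vector `v_+ ⊗ ⋯ ⊗ v_+` is cyclic for the spin representation. -/
theorem spinVec_mem_of_stable {W : Submodule ℂ (SpinSpace n)}
    (hW : ∀ a, ∀ v ∈ W, spinRep n hn κ₀ κ κₙ ψ₀ ψₙ a v ∈ W) (h0 : spinVec 0 ∈ W)
    (ε : Fin n → Fin 2) : spinVec ε ∈ W := by
  -- Induction on the number p of leading legs that may be v_-: the v_- are created from left to
  -- right, each by one A_{p+1}, and the factor ψ_n is a unit.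
  have key : ∀ p ≤ n, ∀ ε : Fin n → Fin 2, (∀ k : Fin n, p ≤ k → ε k = 0) → spinVec ε ∈ W := by
    intro p
    induction p with
    | zero =>
      intro _ ε h
      rwa [show ε = 0 from funext fun k => h k (Nat.zero_le _)]
    | succ p ih =>
      intro hp ε h
      have hε : ∀ k : Fin n, p ≤ k → Function.update ε ⟨p, hp⟩ 0 k = 0 := by
        intro k hk
        by_cases e : k = ⟨p, hp⟩
        · rw [e, Function.update_self]
        · rw [Function.update_of_ne e]
          refine h k (Nat.lt_of_le_of_ne hk fun e' => e (Fin.ext e'.symm))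
      have hmem := ih (by omega) _ hε
      by_cases h1 : ε ⟨p, hp⟩ = 0
      · rwa [← h1, Function.update_eq_self] at hmem
      · have h2 : ε ⟨p, hp⟩ = 1 := by omega
        have h3 := hW (tailProd n (fun k => braidToHecke n κ₀ κ κₙ (sigma n k)) (p + 1)) _ hmem
        have e := map_tailProd n
          ((spinRep n hn κ₀ κ κₙ ψ₀ ψₙ : _ →* Module.End ℂ (SpinSpace n)))
          (fun k => braidToHecke n κ₀ κ κₙ (sigma n k)) (p + 1)
        simp only [MonoidHom.coe_coe] at e
        rw [e] at h3
        change tailProd n (spinOp n hn κ₀ κ κₙ ψ₀ ψₙ) (p + 1) _ ∈ W at h3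
        rw [tailProd_spinVec n hn κ₀ κ κₙ ψ₀ ψₙ hp hε, Function.update_idem, ← h2,
          Function.update_eq_self] at h3
        exact (Submodule.smul_mem_iff _ ψₙ.ne_zero).1 h3
  exact key n le_rfl ε fun k hk => absurd k.2 (by omega)

/-! ### Dimension of the spin space and the weight of v_+ ⊗ ⋯ ⊗ v_+ -/

/-- The basis of `(ℂ²)^{⊗ n}` of the pure tensors `v_{ε_1} ⊗ ⋯ ⊗ v_{ε_n}`. -/
def spinBasis : Module.Basis (Fin n → Fin 2) ℂ (SpinSpace n) :=
  Basis.piTensorProduct fun _ => Pi.basisFun ℂ (Fin 2)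

theorem spinBasis_apply (ε : Fin n → Fin 2) : spinBasis n ε = spinVec ε := by
  simp [spinBasis, spinVec]

theorem finrank_spinSpace : Module.finrank ℂ (SpinSpace n) = 2 ^ n := by
  rw [Module.finrank_eq_card_basis (spinBasis n)]
  simp

/-- With i counted from 0, the factors T_{n-1} ⋯ T_{i+1} give κ^{n-1-i}, the product T_0 ⋯ T_n gives
ψ_0 ψ_n, and the i inverses give κ^{-i}; the total exponent of κ is n - 1 - 2i. -/
theorem spinRep_braidG (i : Fin n) :
    spinRep n hn κ₀ κ κₙ ψ₀ ψₙ (braidToHecke n κ₀ κ κₙ (braidG n i)) (spinVec 0) =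
      (zeta n κ ψ₀ ψₙ i : ℂ) • spinVec 0 := by
  let π : BraidGroup n →* Module.End ℂ (SpinSpace n) :=
    (spinRep n hn κ₀ κ κₙ ψ₀ ψₙ : _ →* Module.End ℂ (SpinSpace n)).comp (braidToHecke n κ₀ κ κₙ)
  have hm : ∀ k, 1 ≤ k → k < n → π (sigma n k) (spinVec 0) = (κ : ℂ) • spinVec 0 :=
    fun k h1 hk => spinOp_mid_eigen n hn κ₀ κ κₙ ψ₀ ψₙ h1 hk rfl rfl
  have h0 : tailProd n (fun k => π (sigma n k)) 0 (spinVec 0) =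
      ((ψ₀ * ψₙ : ℂˣ) : ℂ) • spinVec 0 := tailProd_zero_spinVec n hn κ₀ κ κₙ ψ₀ ψₙ
  have hl := list_prod_apply_eigen (f := fun k => π (sigma n (k + 1))⁻¹) (m := spinVec 0)
    (a := ((κ⁻¹ : ℂˣ) : ℂ)) (List.range i).reverse fun k hk => by
      rw [List.mem_reverse, List.mem_range] at hk
      exact inv_apply_eigen π (hm (k + 1) (by omega) (by omega))
  have h := braidG_apply π hm i
  rw [h0, map_smul, hl, smul_smul, smul_smul, ← Units.val_pow_eq_pow_val, ← Units.val_mul,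
    ← Units.val_mul, List.length_reverse, List.length_range] at h
  refine h.trans ?_
  congr 2
  have hi := i.2
  rw [zeta, mul_right_comm, mul_comm, inv_pow, ← zpow_natCast, ← zpow_natCast, ← zpow_neg,
    ← zpow_add]
  congr 2
  omega

theorem spinRep_Y (l : Fin n → ℤ) :
    spinRep n hn κ₀ κ κₙ ψ₀ ψₙ (Y n κ₀ κ κₙ l) (spinVec 0) =
      ((∏ i, zeta n κ ψ₀ ψₙ i ^ l i : ℂˣ) : ℂ) • spinVec 0 := by
  let π : BraidGroup n →* Module.End ℂ (SpinSpace n) :=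
    (spinRep n hn κ₀ κ κₙ ψ₀ ψₙ : _ →* Module.End ℂ (SpinSpace n)).comp (braidToHecke n κ₀ κ κₙ)
  exact list_ofFn_prod_apply_eigen π _ _ fun i =>
    zpow_apply_eigen π (spinRep_braidG n hn κ₀ κ κₙ ψ₀ ψₙ i) (l i)

theorem spinRep_T_of_mem {i : Fin n} (hi : i ∈ setJ n) :
    spinRep n hn κ₀ κ κₙ ψ₀ ψₙ (T n κ₀ κ κₙ i.succ) (spinVec 0) = (κ : ℂ) • spinVec 0 :=
  spinOp_mid_eigen n hn κ₀ κ κₙ ψ₀ ψₙ (k := i + 1) (by omega) hi rfl rfl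

theorem heckeParam_succ {i : Fin n} (hi : i ∈ setJ n) : heckeParam n κ₀ κ κₙ i.succ = κ := by
  have h : (i : ℕ) + 1 < n := hi
  rw [heckeParam, if_neg (by simp), if_neg (by rw [Fin.val_succ]; omega)]

theorem spinVec_zero_ne : (spinVec 0 : SpinSpace n) ≠ 0 := by
  rw [← spinBasis_apply]
  exact (spinBasis n).ne_zero 0

end Spin

/-! ### The principal series module `M_J(ζ)` -/

section PrincipalSeries

variable {n : ℕ} {κ₀ κ κₙ ψ₀ ψₙ : ℂˣ}

theorem zeta_mem_torusSub : zeta n κ ψ₀ ψₙ ∈ torusSub n κ₀ κ κₙ (setJ n) := by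
  constructor
  · intro i hi h
    have : (i : ℕ) + 1 < n := hi
    omega
  · intro i _ j hj
    rw [zeta, zeta, mul_div_mul_left_eq_div, div_eq_mul_inv, ← zpow_sub, ← zpow_natCast]
    congr 1
    rw [hj]
    push_cast
    ring

theorem IsPrincipalChar.unique {I : Set (Fin n)} {γ : Fin n → ℂˣ}
    {χ χ' : heckeSub n κ₀ κ κₙ I →ₐ[ℂ] ℂ} (h : IsPrincipalChar n κ₀ κ κₙ I γ χ)
    (h' : IsPrincipalChar n κ₀ κ κₙ I γ χ') : χ = χ' := by
  refine AlgHom.adjoin_ext fun x hx => ?_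
  rcases hx with ⟨i, hi, rfl⟩ | ⟨l, rfl⟩
  · exact (h.1 i hi).trans (h'.1 i hi).symm
  · exact (h.2 l).trans (h'.2 l).symm

/-- The character is read off from the line spanned by v_+ ⊗ ⋯ ⊗ v_+, so no relations of H_J have to
be checked. The second conjunct keeps the eigenvector property that Frobenius reciprocity requires.
-/
theorem exists_isPrincipalChar (hn : 2 ≤ n) : ∃ χ : heckeSub n κ₀ κ κₙ (setJ n) →ₐ[ℂ] ℂ,
    IsPrincipalChar n κ₀ κ κₙ (setJ n) (zeta n κ ψ₀ ψₙ) χ ∧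
    ∀ b : heckeSub n κ₀ κ κₙ (setJ n),
      spinRep n hn κ₀ κ κₙ ψ₀ ψₙ b (spinVec 0) = χ b • spinVec 0 := by
  obtain ⟨χ, hχ⟩ := exists_char_of_eigenvector (spinRep n hn κ₀ κ κₙ ψ₀ ψₙ)
    (s := (fun i : Fin n => T n κ₀ κ κₙ i.succ) '' setJ n ∪ Set.range (Y n κ₀ κ κₙ))
    (spinVec_zero_ne n) (by
      rintro x (⟨i, hi, rfl⟩ | ⟨l, rfl⟩)
      · exact ⟨_, spinRep_T_of_mem n hn κ₀ κ κₙ ψ₀ ψₙ hi⟩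
      · exact ⟨_, spinRep_Y n hn κ₀ κ κₙ ψ₀ ψₙ l⟩)
  refine ⟨χ, ⟨fun i hi => ?_, fun l => ?_⟩, hχ⟩
  · refine smul_left_injective ℂ (spinVec_zero_ne n) ((hχ _).symm.trans ?_)
    rw [heckeParam_succ n κ₀ κ κₙ hi]
    exact spinRep_T_of_mem n hn κ₀ κ κₙ ψ₀ ψₙ hi
  · exact smul_left_injective ℂ (spinVec_zero_ne n)
      ((hχ _).symm.trans (spinRep_Y n hn κ₀ κ κₙ ψ₀ ψₙ l))

variable {χ : heckeSub n κ₀ κ κₙ (setJ n) →ₐ[ℂ] ℂ}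

/-- The module `M_J(ζ)` is spanned by the vectors `A_{p_k} ⋯ A_{p_1} (1 ⊗ 1)` with
`1 ≤ p_1 < ⋯ < p_k ≤ n`, where `A_p = T_p ⋯ T_n`. -/
theorem orbitSpan_principalSeries_eq_top (hn : 2 ≤ n)
    (hχ : IsPrincipalChar n κ₀ κ κₙ (setJ n) (zeta n κ ψ₀ ψₙ) χ) :
    orbitSpan n (fun k => principalSeries n κ₀ κ κₙ (setJ n) χ
      (braidToHecke n κ₀ κ κₙ (sigma n k))) (inducedVec _ χ) n = ⊤ := by
  let π : BraidGroup n →* Module.End ℂ (Induced (heckeSub n κ₀ κ κₙ (setJ n)) χ) :=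
    (principalSeries n κ₀ κ κₙ (setJ n) χ : _ →* Module.End ℂ _).comp (braidToHecke n κ₀ κ κₙ)
  have hm : ∀ k, 1 ≤ k → k < n →
      π (sigma n k) (inducedVec _ χ) = (κ : ℂ) • inducedVec _ χ := by
    intro k h1 hk
    obtain ⟨k, rfl⟩ : ∃ j, k = j + 1 := ⟨k - 1, by omega⟩
    have hi : (⟨k, by omega⟩ : Fin n) ∈ setJ n := hk
    have h := inducedRep_inducedVec _ χ ⟨_, T_mem_heckeSub κ₀ κ κₙ hi⟩
    rw [hχ.1 _ hi, heckeParam_succ n κ₀ κ κₙ hi] at h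
    exact h
  -- The character at λ = (1, 0, …, 0) gives the eigenvalue ζ_1 of Y_1 on 1 ⊗ 1.
  have hY : π (braidG n ⟨0, by omega⟩) (inducedVec _ χ) =
      ((zeta n κ ψ₀ ψₙ ⟨0, by omega⟩ : ℂˣ) : ℂ) • inducedVec _ χ := by
    have h := inducedRep_inducedVec _ χ
      ⟨_, Y_mem_heckeSub κ₀ κ κₙ (setJ n) (Pi.single ⟨0, by omega⟩ 1)⟩
    rw [hχ.2, Finset.prod_eq_single ⟨0, by omega⟩ (fun j _ hj => by simp [hj]) (by simp)] at h
    simp only [Pi.single_eq_same, zpow_one, Y, braidGPow_single] at h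
    exact h
  have h0 := tailProd_apply_of_braidG (by omega) π hm hY
  have hst := fun j (hj : j ≤ n) x hx => orbitSpan_stable (x := x) (by omega)
    ((isBraidFamily_sigma n).map π)
    (fun i hi => by
      have h := congrArg (principalSeries n κ₀ κ κₙ (setJ n) χ) (braidToHecke_quad n κ₀ κ κₙ hi)
      rw [map_mul, map_add, map_smul, map_one] at h
      exact h) hm
    (Units.ne_zero _) h0 hj hx
  rw [eq_top_iff]
  rintro x -
  obtain ⟨a, rfl⟩ := exists_inducedRep_inducedVec _ χ x
  exact stable_of_generators (principalSeries n κ₀ κ κₙ (setJ n) χ) _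
    (hst) a (mem_orbitSpan n)

theorem repIso_principalSeries (hn : 2 ≤ n)
    (hχ : IsPrincipalChar n κ₀ κ κₙ (setJ n) (zeta n κ ψ₀ ψₙ) χ) :
    RepIso (spinRep n hn κ₀ κ κₙ ψ₀ ψₙ) (principalSeries n κ₀ κ κₙ (setJ n) χ) := by
  obtain ⟨χ', hχ', hv⟩ := exists_isPrincipalChar hn (κ₀ := κ₀) (κ := κ) (κₙ := κₙ)
    (ψ₀ := ψ₀) (ψₙ := ψₙ)
  -- By uniqueness the given χ is the character by which H_J acts on v_+ ⊗ ⋯ ⊗ v_+.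
  obtain rfl := hχ.unique hχ'
  obtain ⟨Φ, hΦ, hΦ1⟩ := exists_inducedMap _ χ (spinRep n hn κ₀ κ κₙ ψ₀ ψₙ) hv
  have hsurj : Function.Surjective Φ := by
    rw [← LinearMap.range_eq_top, eq_top_iff, ← (spinBasis n).span_eq, Submodule.span_le]
    rintro _ ⟨ε, rfl⟩
    rw [spinBasis_apply]
    refine spinVec_mem_of_stable n hn κ₀ κ κₙ ψ₀ ψₙ ?_ (hΦ1 ▸ LinearMap.mem_range_self Φ _) ε
    rintro a _ ⟨x, rfl⟩
    exact ⟨_, hΦ a x⟩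
  obtain ⟨hfin, hdim⟩ := finrank_orbitSpan_le (n := n)
    (t := fun k => principalSeries n κ₀ κ κₙ (setJ n) χ (braidToHecke n κ₀ κ κₙ (sigma n k)))
    (m := inducedVec _ χ) n
  rw [orbitSpan_principalSeries_eq_top hn hχ] at hfin hdim
  have hfin' : Module.Finite ℂ (Induced (heckeSub n κ₀ κ κₙ (setJ n)) χ) :=
    Module.Finite.equiv Submodule.topEquiv
  have hfinS : Module.Finite ℂ (SpinSpace n) := Module.Finite.of_basis (spinBasis n)
  rw [finrank_top, ← finrank_spinSpace n] at hdim
  -- The spanning set bounds the dimension of M_J(ζ) by 2^n and surjectivity bounds it below by 2^n,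
  -- so Φ is a surjection between spaces of equal finite dimension.
  have hinj : Function.Injective Φ :=
    (LinearMap.injective_iff_surjective_of_finrank_eq_finrank
      (le_antisymm hdim (LinearMap.finrank_le_finrank_of_surjective hsurj))).2 hsurj
  let e := LinearEquiv.ofBijective Φ ⟨hinj, hsurj⟩
  refine ⟨e.symm, fun a v => ?_⟩
  rw [LinearEquiv.symm_apply_eq]
  have h := hΦ a (e.symm v)
  change _ = spinRep n hn κ₀ κ κₙ ψ₀ ψₙ a (e (e.symm v)) at h
  rw [LinearEquiv.apply_symm_apply] at h
  exact h.symm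

end PrincipalSeries

end

end SpinHecke

/-- The spin representation is isomorphic to the principal series module `M_J(ζ)`; this includes
that `M_J(ζ)` is well defined: `ζ` lies in `T_J` and `H_J` has a unique character `χ_{J,ζ}`. -/
theorem proposition3p3 (n : ℕ) (hn : 2 ≤ n) (κ₀ κ κₙ ψ₀ ψₙ : ℂˣ) :
    SpinHecke.zeta n κ ψ₀ ψₙ ∈ SpinHecke.torusSub n κ₀ κ κₙ (SpinHecke.setJ n) ∧
    (∃! χ : SpinHecke.heckeSub n κ₀ κ κₙ (SpinHecke.setJ n) →ₐ[ℂ] ℂ,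
      SpinHecke.IsPrincipalChar n κ₀ κ κₙ (SpinHecke.setJ n) (SpinHecke.zeta n κ ψ₀ ψₙ) χ) ∧
    ∀ χ : SpinHecke.heckeSub n κ₀ κ κₙ (SpinHecke.setJ n) →ₐ[ℂ] ℂ,
      SpinHecke.IsPrincipalChar n κ₀ κ κₙ (SpinHecke.setJ n) (SpinHecke.zeta n κ ψ₀ ψₙ) χ →
      SpinHecke.RepIso (SpinHecke.spinRep n hn κ₀ κ κₙ ψ₀ ψₙ)
        (SpinHecke.principalSeries n κ₀ κ κₙ (SpinHecke.setJ n) χ) := by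
  refine ⟨SpinHecke.zeta_mem_torusSub, ?_, fun χ hχ => SpinHecke.repIso_principalSeries hn hχ⟩
  obtain ⟨χ, hχ, -⟩ := SpinHecke.exists_isPrincipalChar hn (κ₀ := κ₀) (κ := κ) (κₙ := κₙ)
    (ψ₀ := ψ₀) (ψₙ := ψₙ)
  exact ⟨χ, hχ, fun χ' h => h.unique hχ⟩
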